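/- Let $N\ge 2$, let $\alpha\in(0,1)$, and let $\Omega\subset\mathbb R^N$ be a bounded domain (a bounded, nonempty, connected open set) of class $C^{4,\alpha}$. For $\sigma\in[0,1)$ consider the Neumann eigenvalue problem for the biharmonic operator with Poisson ratio $\sigma$ in its weak form: find $\lambda\in\mathbb R$ and $0\neq u\in H^2(\Omega)$ such that $$\int_\Omega (1-\sigma)\,D^2u:D^2\varphi+\sigma\,\Delta u\,\Delta\varphi\,dx=\lambda\int_\Omega u\,\varphi\,dx\qquad\text{for all }\varphi\in H^2(\Omega),$$ where $D^2u:D^2\varphi=\sum_{i,k=1}^N\frac{\partial^2u}{\partial x_i\partial x_k}\frac{\partial^2\varphi}{\partial x_i\partial x_k}$. For every $\sigma\in[0,1)$ the eigenvalues of this problem have finite multiplicity and form a sequence $$\lambda_1(\sigma)\le\lambda_2(\sigma)\le\cdots\le\lambda_j(\sigma)\le\cdots\to+\infty,$$ in which each eigenvalue is repeated according to its multiplicity. For every $j\in\{1,2,\dots\}$, $$\lim_{\sigma\to1^-}\lambda_j(\sigma)=0,$$ and the function $\sigma\mapsto\lambda_j(\sigma)$, extended to $\sigma=1$ by $\lambda_j(1)=0$,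 is Lipschitz continuous on $[0,1]$. -/

import Mathlib

open Set Filter Topology MeasureTheory
open scoped NNReal ENNReal ContDiff

noncomputable section

namespace NeumannBiharmonic

/-- `N`-dimensional Euclidean space. -/
abbrev Euc (N : ℕ) : Type := EuclideanSpace ℝ (Fin N)

/-- `Ω` has boundary of class `C^{k,α}`: near each boundary point, and after a choice of a
direction `e` (the vertical direction), `Ω` is the set of points below the graph of a
function of class `C^{k,α}` of the variables orthogonal to `e`. -/
def HasHolderBoundary {N : ℕ} (k : ℕ) (α : ℝ≥0) (Ω : Set (Euc N)) : Prop :=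
  ∀ x₀ ∈ frontier Ω, ∃ (e : Euc N) (U : Set (Euc N)) (γ : ((ℝ ∙ e)ᗮ : Submodule ℝ (Euc N)) → ℝ),
    ‖e‖ = 1 ∧ IsOpen U ∧ x₀ ∈ U ∧
    ContDiff ℝ k γ ∧ (∃ C : ℝ≥0, HolderWith C α (iteratedFDeriv ℝ k γ)) ∧
    ∀ x ∈ U, (x ∈ Ω ↔ inner ℝ e x < γ ((ℝ ∙ e)ᗮ.orthogonalProjectionOnto x))

/-- A bounded domain (nonempty connected open set) of class `C^{k,α}`. -/
structure IsBoundedHolderDomain {N : ℕ} (k : ℕ) (α : ℝ≥0) (Ω : Set (Euc N)) : Prop where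
  isOpen : IsOpen Ω
  isConnected : IsConnected Ω
  isBounded : Bornology.IsBounded Ω
  boundary : HasHolderBoundary k α Ω

/-- The real space `L²(Ω)`. -/
abbrev L2 {N : ℕ} (Ω : Set (Euc N)) : Type := Lp ℝ 2 (volume.restrict Ω)

/-- `g ∈ L²(Ω)` is the weak partial derivative `∂u/∂x_i` of `u ∈ L²(Ω)`. -/
def IsWeakPartial {N : ℕ} (Ω : Set (Euc N)) (i : Fin N) (u g : L2 Ω) : Prop :=
  ∀ φ : Euc N → ℝ, ContDiff ℝ ∞ φ → HasCompactSupport φ → tsupport φ ⊆ Ω →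
    ∫ x in Ω, u x * fderiv ℝ φ x (EuclideanSpace.single i 1) = -∫ x in Ω, g x * φ x

section Helpers

variable {N : ℕ} {Ω : Set (Euc N)}

theorem integrable_mul_of_hasCompactSupport (u : L2 Ω) {ψ : Euc N → ℝ} (hψ : Continuous ψ)
    (hs : HasCompactSupport ψ) : Integrable (fun x => u x * ψ x) (volume.restrict Ω) :=
  (Lp.memLp u).integrable_mul (q := 2) (hψ.memLp_of_hasCompactSupport hs)

theorem integral_add_mul (u v : L2 Ω) {ψ : Euc N → ℝ} (hψ : Continuous ψ)
    (hs : HasCompactSupport ψ) :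
    ∫ x in Ω, (u + v : L2 Ω) x * ψ x = (∫ x in Ω, u x * ψ x) + ∫ x in Ω, v x * ψ x := by
  rw [← integral_add (integrable_mul_of_hasCompactSupport u hψ hs)
    (integrable_mul_of_hasCompactSupport v hψ hs)]
  refine integral_congr_ae ?_
  filter_upwards [Lp.coeFn_add u v] with x hx
  rw [hx, Pi.add_apply, add_mul]

theorem integral_smul_mul (c : ℝ) (u : L2 Ω) (ψ : Euc N → ℝ) :
    ∫ x in Ω, (c • u : L2 Ω) x * ψ x = c * ∫ x in Ω, u x * ψ x := by
  rw [← integral_const_mul]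
  refine integral_congr_ae ?_
  filter_upwards [Lp.coeFn_smul c u] with x hx
  rw [hx, Pi.smul_apply, smul_eq_mul, mul_assoc]

theorem continuous_partial {φ : Euc N → ℝ} (hφ : ContDiff ℝ ∞ φ) (i : Fin N) :
    Continuous fun x => fderiv ℝ φ x (EuclideanSpace.single i 1) :=
  (hφ.continuous_fderiv (by simp)).clm_apply continuous_const

theorem IsWeakPartial.add {i : Fin N} {u v g h : L2 Ω} (hu : IsWeakPartial Ω i u g)
    (hv : IsWeakPartial Ω i v h) : IsWeakPartial Ω i (u + v) (g + h) := by
  intro φ hφ hc hs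
  rw [integral_add_mul u v (continuous_partial hφ i) (hc.fderiv_apply ℝ _),
    integral_add_mul g h hφ.continuous hc, hu φ hφ hc hs, hv φ hφ hc hs]
  ring

theorem IsWeakPartial.smul (c : ℝ) {i : Fin N} {u g : L2 Ω} (hu : IsWeakPartial Ω i u g) :
    IsWeakPartial Ω i (c • u) (c • g) := by
  intro φ hφ hc hs
  rw [integral_smul_mul, integral_smul_mul, hu φ hφ hc hs, mul_neg]

theorem IsWeakPartial.zero (i : Fin N) : IsWeakPartial Ω i 0 0 := by
  intro φ _ _ _
  have h : ∀ ψ : Euc N → ℝ, ∫ x in Ω, (0 : L2 Ω) x * ψ x = 0 := fun ψ => by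
    have := integral_smul_mul (Ω := Ω) 0 0 ψ
    simpa using this
  rw [h, h, neg_zero]

/-- Weak partial derivatives in an open set are unique. -/
theorem IsWeakPartial.unique (hΩ : IsOpen Ω) {i : Fin N} {u g h : L2 Ω}
    (hg : IsWeakPartial Ω i u g) (hh : IsWeakPartial Ω i u h) : g = h := by
  have hsub : ∀ᵐ x ∂(volume.restrict Ω), x ∈ Ω → (g - h : L2 Ω) x = 0 := by
    refine hΩ.ae_eq_zero_of_integral_contDiff_smul_eq_zero ?_ ?_
    · exact ((Lp.memLp (g - h)).locallyIntegrable (by norm_num)).locallyIntegrableOn Ω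
    · intro φ hφ hc hs
      have e := hg.add (hh.smul (-1)) φ hφ hc hs
      have e0 := (IsWeakPartial.zero (Ω := Ω) i) φ hφ hc hs
      have h1 : u + (-1 : ℝ) • u = 0 := by rw [neg_one_smul, add_neg_cancel]
      have h2 : g + (-1 : ℝ) • h = g - h := by rw [neg_one_smul, sub_eq_add_neg]
      rw [h1, h2, e0] at e
      have e1 := integral_smul_mul (Ω := Ω) 0 0 φ
      simp only [zero_smul, zero_mul] at e1
      rw [e1] at e
      simp only [smul_eq_mul]
      have : (fun x => φ x * (g - h : L2 Ω) x) = fun x => (g - h : L2 Ω) x * φ x := by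
        funext x; ring
      rw [this]
      linarith
  have h0 : g - h = 0 := by
    apply Lp.ext
    filter_upwards [hsub, ae_restrict_mem hΩ.measurableSet, Lp.coeFn_zero ℝ 2 (volume.restrict Ω)]
      with x hx hm h0
    rw [hx hm, h0, Pi.zero_apply]
  exact sub_eq_zero.mp h0

end Helpers

/-- The Sobolev space `H²(Ω)`. An element is a function `u ∈ L²(Ω)` together with its (unique)
weak partial derivatives of order one and two, all of which belong to `L²(Ω)`: it is recorded
as the triple `(u, (∂_i u)_i, (∂_j ∂_i u)_{i,j})`. -/
def SobolevH2 {N : ℕ} (Ω : Set (Euc N)) :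
    Submodule ℝ (L2 Ω × (Fin N → L2 Ω) × (Fin N → Fin N → L2 Ω)) where
  carrier := {p | (∀ i, IsWeakPartial Ω i p.1 (p.2.1 i)) ∧
    ∀ i j, IsWeakPartial Ω j (p.2.1 i) (p.2.2 i j)}
  add_mem' hp hq := ⟨fun i => (hp.1 i).add (hq.1 i), fun i j => (hp.2 i j).add (hq.2 i j)⟩
  zero_mem' := ⟨fun i => .zero i, fun _ j => .zero j⟩
  smul_mem' c _ hp := ⟨fun i => (hp.1 i).smul c, fun i j => (hp.2 i j).smul c⟩

namespace SobolevH2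

variable {N : ℕ} {Ω : Set (Euc N)}

/-- The underlying `L²` function of an element of `H²(Ω)`. -/
def fn (u : SobolevH2 Ω) : L2 Ω := u.1.1

/-- The weak second derivative `∂²u/∂x_i∂x_j`. -/
def hess (u : SobolevH2 Ω) (i j : Fin N) : L2 Ω := u.1.2.2 i j

/-- In an open set, an element of `H²(Ω)` is determined by its underlying function. -/
theorem ext_fn (hΩ : IsOpen Ω) {u v : SobolevH2 Ω} (h : (fn u) = (fn v)) : u = v := by
  obtain ⟨⟨u, du, ddu⟩, hu⟩ := u
  obtain ⟨⟨v, dv, ddv⟩, hv⟩ := v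
  change u = v at h
  subst h
  have h1 : du = dv := funext fun i => (hu.1 i).unique hΩ (hv.1 i)
  subst h1
  have h2 : ddu = ddv := funext fun i => funext fun j => (hu.2 i j).unique hΩ (hv.2 i j)
  subst h2
  rfl

/-- The (weak) Laplacian `Δu`. -/
def lap (u : SobolevH2 Ω) : L2 Ω := ∑ i, hess u i i

/-- `∫_Ω D²u : D²v dx`. -/
def hessForm (u v : SobolevH2 Ω) : ℝ := ∫ x in Ω, ∑ i, ∑ j, hess u i j x * hess v i j x

/-- `∫_Ω Δu Δv dx`. -/
def lapForm (u v : SobolevH2 Ω) : ℝ := ∫ x in Ω, (lap u) x * (lap v) x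

/-- `∫_Ω u v dx`. -/
def massForm (u v : SobolevH2 Ω) : ℝ := ∫ x in Ω, (fn u) x * (fn v) x

theorem integral_mul_eq_inner (f g : L2 Ω) : ∫ x in Ω, f x * g x = inner ℝ f g := by
  rw [L2.inner_def]
  refine integral_congr_ae (Eventually.of_forall fun x => ?_)
  simp [mul_comm]

theorem hessForm_eq (u v : SobolevH2 Ω) :
    hessForm u v = ∑ i, ∑ j, inner ℝ (hess u i j) (hess v i j) := by
  have hint : ∀ i j, Integrable (fun x => hess u i j x * hess v i j x) (volume.restrict Ω) :=
    fun i j => (Lp.memLp (hess u i j)).integrable_mul (q := 2) (Lp.memLp (hess v i j))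
  unfold hessForm
  rw [integral_finsetSum _ fun i _ => integrable_finsetSum _ fun j _ => hint i j]
  refine Finset.sum_congr rfl fun i _ => ?_
  rw [integral_finsetSum _ fun j _ => hint i j]
  exact Finset.sum_congr rfl fun j _ => integral_mul_eq_inner _ _

theorem lapForm_eq (u v : SobolevH2 Ω) : lapForm u v = inner ℝ (lap u) (lap v) :=
  integral_mul_eq_inner _ _

theorem massForm_eq (u v : SobolevH2 Ω) : massForm u v = inner ℝ (fn u) (fn v) :=
  integral_mul_eq_inner _ _

end SobolevH2

open SobolevH2

/-- The bilinear form `∫_Ω (1 - σ) D²u : D²v + σ Δu Δv dx` on `H²(Ω)`. -/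
def plateForm {N : ℕ} (Ω : Set (Euc N)) (σ : ℝ) (u v : SobolevH2 Ω) : ℝ :=
  (1 - σ) * hessForm u v + σ * lapForm u v

/-- The space of all `u ∈ H²(Ω)` that satisfy the weak form of the Neumann problem with
Poisson ratio `σ` and spectral parameter `t`:
`∫_Ω (1 - σ) D²u : D²φ + σ Δu Δφ dx = t ∫_Ω u φ dx` for all `φ ∈ H²(Ω)`. -/
def neumannEigenspace {N : ℕ} (Ω : Set (Euc N)) (σ t : ℝ) : Submodule ℝ (SobolevH2 Ω) where
  carrier := {u | ∀ φ : SobolevH2 Ω, plateForm Ω σ u φ = t * massForm u φ}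
  add_mem' {u v} hu hv φ := by
    have hu := hu φ
    have hv := hv φ
    simp only [plateForm, hessForm_eq, lapForm_eq, massForm_eq] at hu hv ⊢
    have h1 : ∀ i j, hess (u + v) i j = hess u i j + hess v i j := fun _ _ => rfl
    have h2 : fn (u + v) = (fn u) + (fn v) := rfl
    have h3 : lap (u + v) = (lap u) + (lap v) := by
      simp only [lap, h1, Finset.sum_add_distrib]
    simp only [h1, h2, h3, inner_add_left, Finset.sum_add_distrib]
    linarith
  zero_mem' φ := by
    simp only [plateForm, hessForm_eq, lapForm_eq, massForm_eq]
    have h1 : ∀ i j, hess (0 : SobolevH2 Ω) i j = 0 := fun _ _ => rfl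
    have h2 : fn (0 : SobolevH2 Ω) = 0 := rfl
    simp [lap, h1, h2]
  smul_mem' c u hu φ := by
    have hu := hu φ
    simp only [plateForm, hessForm_eq, lapForm_eq, massForm_eq] at hu ⊢
    have h1 : ∀ i j, hess (c • u) i j = c • hess u i j := fun _ _ => rfl
    have h2 : fn (c • u) = c • (fn u) := rfl
    have h3 : lap (c • u) = c • (lap u) := by
      simp only [lap, h1, Finset.smul_sum]
    simp only [h1, h2, h3, real_inner_smul_left, ← Finset.mul_sum]
    linear_combination c * hu

/-- The `j`-th Neumann eigenvalue `λ_j(σ)` (`j = 1, 2, …`), in increasing order and counted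
with multiplicity: the least `t` such that the eigenspaces of the eigenvalues `s ≤ t`
together have dimension at least `j`. -/
def neumannEigenvalue {N : ℕ} (Ω : Set (Euc N)) (j : ℕ) (σ : ℝ) : ℝ :=
  sInf {t : ℝ | (j : Cardinal) ≤
    Module.rank ℝ ↥(⨆ s : Iic t, neumannEigenspace Ω σ (s : ℝ))}

/-- The sequence `lam 1 ≤ lam 2 ≤ …` lists all the eigenvalues of the Neumann problem with
Poisson ratio `σ`: it diverges to `+∞`, and every real `t` has a finite-dimensional eigenspace
whose dimension is the number of indices `j ≥ 1` with `lam j = t`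
(so that this number is `0` exactly when `t` is not an eigenvalue). -/
structure ListsNeumannEigenvalues {N : ℕ} (Ω : Set (Euc N)) (σ : ℝ) (lam : ℕ → ℝ) : Prop where
  mono : ∀ j k : ℕ, 1 ≤ j → j ≤ k → lam j ≤ lam k
  tendsto : Tendsto lam atTop atTop
  finite : ∀ t : ℝ, Module.Finite ℝ (neumannEigenspace Ω σ t)
  multiplicity : ∀ t : ℝ,
    Module.finrank ℝ (neumannEigenspace Ω σ t) = Set.ncard {j : ℕ | 1 ≤ j ∧ lam j = t}

end NeumannBiharmonic

end

/-! Write A(u) for the squared L² norm of the Hessian and B(u) for that of the Laplacian. The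
quadratic form is (1 - σ) A + σ B, affine in σ, with B ≤ N A by Cauchy–Schwarz on the trace.

The eigenvalue is O(1 - σ) because a harmonic u contributes only (1 - σ) A(u). For N ≥ 2 the
functions exp(n x_a) cos(n (x_b - p)) span harmonic subspaces of every finite dimension
(`exists_harmonic_submodule`). On one of dimension j, A is at most C times the squared L² norm, so
the minimax principle gives λ_j(σ) ≤ C (1 - σ), with C independent of σ.

The same bound yields the Lipschitz estimate (`neumannEigenvalue_le_add`). On the sum of the
eigenspaces up to λ_j(σ) one has (1 - σ) A ≤ λ_j(σ) ≤ C (1 - σ) per unit mass, and the degenerating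
factor cancels: A ≤ C uniformly in σ. Passing from σ to τ changes the form by (τ - σ)(B - A), which
is at most N C |τ - σ| per unit mass there, so minimax applies again.

Minimax and the listing of the spectrum are proved for an abstract closed form with compactly
embedded domain (`IsSpectralForm`), by minimising Rayleigh quotients on orthogonal complements. That
the plate form is such a form for σ < 1 rests on Rellich's theorem, obtained by averaging over small
translations pointing into Ω, and on the bound of first derivatives by the function and its Hessian.
-/

noncomputable section

namespace NeumannBiharmonic

/-! ### Spectral theory of closed nonnegative forms with compactly embedded domain -/

section AbstractForm

variable {V H : Type*} [AddCommGroup V] [Module ℝ V] [NormedAddCommGroup H]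
  [InnerProductSpace ℝ H]

/-- A symmetric nonnegative bilinear form `a` on `V`, where `V` is embedded by `ι` in an inner
product space, that is closed and whose form domain is compactly embedded. -/
structure IsSpectralForm (ι : V →ₗ[ℝ] H) (a : V →ₗ[ℝ] V →ₗ[ℝ] ℝ) : Prop where
  injective : Function.Injective ι
  symm : ∀ u v, a u v = a v u
  nonneg : ∀ u, 0 ≤ a u u
  compact : ∀ (u : ℕ → V) (R : ℝ), (∀ n, ‖ι (u n)‖ ≤ R) → (∀ n, a (u n) (u n) ≤ R) →
    ∃ φ : ℕ → ℕ, StrictMono φ ∧ CauchySeq fun n => ι (u (φ n))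
  closed : ∀ u : ℕ → V, CauchySeq (fun n => ι (u n)) →
    (∀ ε > 0, ∃ n₀, ∀ n ≥ n₀, ∀ m ≥ n₀, a (u n - u m) (u n - u m) < ε) →
    ∃ w, Tendsto (fun n => ι (u n)) atTop (𝓝 (ι w)) ∧
      Tendsto (fun n => a (u n) (u n)) atTop (𝓝 (a w w))

/-- The eigenspace `{u | a(u, φ) = t ⟪u, φ⟫ for all φ}`. -/
def formEigenspace (ι : V →ₗ[ℝ] H) (a : V →ₗ[ℝ] V →ₗ[ℝ] ℝ) (t : ℝ) : Submodule ℝ V where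
  carrier := {u | ∀ φ, a u φ = t * inner ℝ (ι u) (ι φ)}
  add_mem' hu hv φ := by
    simp only [map_add, LinearMap.add_apply, inner_add_left, hu φ, hv φ, mul_add]
  zero_mem' φ := by simp
  smul_mem' c u hu φ := by
    simp only [map_smul, LinearMap.smul_apply, real_inner_smul_left, hu φ, smul_eq_mul]
    ring

/-- The sum of the eigenspaces of the eigenvalues at most `t`. -/
def formEigensum (ι : V →ₗ[ℝ] H) (a : V →ₗ[ℝ] V →ₗ[ℝ] ℝ) (t : ℝ) : Submodule ℝ V :=
  ⨆ s : Iic t, formEigenspace ι a s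

/-- The `j`-th eigenvalue, counted with multiplicity. -/
def formEigenvalue (ι : V →ₗ[ℝ] H) (a : V →ₗ[ℝ] V →ₗ[ℝ] ℝ) (j : ℕ) : ℝ :=
  sInf {t : ℝ | (j : Cardinal) ≤ Module.rank ℝ (formEigensum ι a t)}

theorem exists_bilin_le_mul_norm_sq {K : Type*} [NormedAddCommGroup K] [NormedSpace ℝ K]
    [FiniteDimensional ℝ K] (B : K →ₗ[ℝ] K →ₗ[ℝ] ℝ) :
    ∃ c : ℝ, 0 ≤ c ∧ ∀ x, B x x ≤ c * ‖x‖ ^ 2 := by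
  let T : K →L[ℝ] (K →L[ℝ] ℝ) := LinearMap.toContinuousLinearMap
    ((LinearMap.toContinuousLinearMap (𝕜 := ℝ) (E := K) (F' := ℝ)).toLinearMap ∘ₗ B)
  refine ⟨‖T‖, T.opNorm_nonneg, fun x => ?_⟩
  calc B x x = T x x := by simp [T]
    _ ≤ ‖T x x‖ := le_abs_self _
    _ ≤ ‖T x‖ * ‖x‖ := (T x).le_opNorm x
    _ ≤ ‖T‖ * ‖x‖ * ‖x‖ := by gcongr; exact T.le_opNorm x
    _ = _ := by ring

/-- Transporting the form to the finite-dimensional normed space `F.map ι` makes it continuous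
there. This supplies both the nonemptiness of the sets defining the eigenvalues and the constant C
in the O(1 - σ) bound. -/
theorem exists_form_le_mul_norm_sq {ι : V →ₗ[ℝ] H} (hι : Function.Injective ι)
    (a : V →ₗ[ℝ] V →ₗ[ℝ] ℝ) (F : Submodule ℝ V) [FiniteDimensional ℝ F] :
    ∃ c : ℝ, 0 ≤ c ∧ ∀ u ∈ F, a u u ≤ c * ‖ι u‖ ^ 2 := by
  let e := Submodule.equivMapOfInjective ι hι F
  obtain ⟨c, hc, h⟩ := exists_bilin_le_mul_norm_sq
    ((a.domRestrict₁₂ F F).compl₁₂ e.symm.toLinearMap e.symm.toLinearMap)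
  refine ⟨c, hc, fun u hu => ?_⟩
  have h' := h (e ⟨u, hu⟩)
  simp only [LinearMap.compl₁₂_apply, LinearEquiv.coe_coe, e.symm_apply_apply] at h'
  exact h'

theorem formEigensum_mono (ι : V →ₗ[ℝ] H) (a : V →ₗ[ℝ] V →ₗ[ℝ] ℝ) {s t : ℝ} (h : s ≤ t) :
    formEigensum ι a s ≤ formEigensum ι a t :=
  iSup_le fun r => le_iSup (fun r : Iic t => formEigenspace ι a r) ⟨r, r.2.trans h⟩

theorem formEigenspace_le_formEigensum (ι : V →ₗ[ℝ] H) (a : V →ₗ[ℝ] V →ₗ[ℝ] ℝ) {s t : ℝ}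
    (h : s ≤ t) : formEigenspace ι a s ≤ formEigensum ι a t :=
  le_iSup (fun r : Iic t => formEigenspace ι a r) ⟨s, h⟩

/-- A finite-dimensional subspace admits orthogonal projections. -/
theorem exists_mem_orthogonal_sub (ι : V →ₗ[ℝ] H) (F : Submodule ℝ V) [FiniteDimensional ℝ F]
    (φ : V) : ∃ f ∈ F, ∀ w ∈ F, inner ℝ (ι w) (ι (φ - f)) = 0 := by
  obtain ⟨f, hf, hf'⟩ := (F.map ι).starProjection_apply_mem (ι φ)
  refine ⟨f, hf, fun w hw => ?_⟩
  rw [map_sub, hf']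
  exact (F.map ι).mem_orthogonal _ |>.1 ((F.map ι).sub_starProjection_mem_orthogonal (ι φ)) _
    (Submodule.mem_map_of_mem hw)

namespace IsSpectralForm

variable {ι : V →ₗ[ℝ] H} {a : V →ₗ[ℝ] V →ₗ[ℝ] ℝ}

theorem inner_eq_zero (h : IsSpectralForm ι a) {s t : ℝ} (hst : s ≠ t) {u v : V}
    (hu : u ∈ formEigenspace ι a s) (hv : v ∈ formEigenspace ι a t) :
    inner ℝ (ι u) (ι v) = 0 := by
  have h1 := hu v
  have h2 := hv u
  rw [h.symm v u, h1, real_inner_comm (ι u) (ι v)] at h2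
  have : (s - t) * inner ℝ (ι u) (ι v) = 0 := by linear_combination h2
  exact (mul_eq_zero.1 this).resolve_left (sub_ne_zero.2 hst)

/-- Eigenspaces of distinct eigenvalues are orthogonal for both the inner product and the form, so
on a finite sum of eigenvectors both sides become diagonal and can be compared term by term. -/
theorem form_le_of_mem (h : IsSpectralForm ι a) {t : ℝ} {u : V} (hu : u ∈ formEigensum ι a t) :
    a u u ≤ t * ‖ι u‖ ^ 2 := by
  obtain ⟨f, hf, hu_def⟩ := (Submodule.mem_iSup_iff_exists_finsupp _ _).1 hu
  replace hu_def : u = ∑ i ∈ f.support, f i := hu_def.symm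
  have h1 : ∀ i ∈ f.support, inner ℝ (ι (f i)) (ι u) = ‖ι (f i)‖ ^ 2 := by
    intro i hi
    nth_rewrite 1 [hu_def]
    rw [map_sum, inner_sum, Finset.sum_eq_single i, real_inner_self_eq_norm_sq]
    · intro j _ hj
      exact h.inner_eq_zero (fun e => hj (Subtype.ext e.symm)) (hf i) (hf j)
    · exact fun hi' => absurd hi hi'
  have h2 : ‖ι u‖ ^ 2 = ∑ i ∈ f.support, ‖ι (f i)‖ ^ 2 := by
    rw [← real_inner_self_eq_norm_sq]
    nth_rewrite 1 [hu_def]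
    rw [map_sum, sum_inner]
    exact Finset.sum_congr rfl h1
  have h3 : a u u = ∑ i ∈ f.support, (i : ℝ) * ‖ι (f i)‖ ^ 2 := by
    nth_rewrite 1 [hu_def]
    rw [map_sum, LinearMap.sum_apply]
    exact Finset.sum_congr rfl fun i hi => by rw [hf i u, h1 i hi]
  rw [h2, h3, Finset.mul_sum]
  exact Finset.sum_le_sum fun i _ => mul_le_mul_of_nonneg_right i.2 (sq_nonneg _)

theorem finiteDimensional (h : IsSpectralForm ι a) (t : ℝ) :
    FiniteDimensional ℝ (formEigensum ι a t) := by
  set F := formEigensum ι a t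
  suffices hK : FiniteDimensional ℝ (F.map ι) from
    LinearEquiv.finiteDimensional (Submodule.equivMapOfInjective ι h.injective F).symm
  by_contra hK
  -- Riesz's lemma: in infinite dimension there is a sequence of norms at most 3 with mutual
  -- distances at least 1. Its form values are at most 9|t|, so compactness would give a Cauchy
  -- subsequence.
  obtain ⟨f, hf, hsep⟩ := exists_seq_norm_le_one_le_norm_sub' (𝕜 := ℝ) (c := 2) (R := 3)
    (by norm_num) (by norm_num) hK
  choose u hu hfu using fun n => (f n).2
  obtain ⟨φ, hφ, hc⟩ := h.compact u (max 3 (|t| * 9))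
    (fun n => by rw [hfu]; exact (hf n).trans (le_max_left _ _))
    (fun n => by
      refine (h.form_le_of_mem (hu n)).trans (le_trans ?_ (le_max_right _ _))
      rw [hfu]
      have h1 : ‖(f n : H)‖ ≤ 3 := hf n
      have h2 : ‖(f n : H)‖ ^ 2 ≤ 9 := by nlinarith [norm_nonneg (f n : H)]
      exact mul_le_mul (le_abs_self t) h2 (sq_nonneg _) (abs_nonneg _))
  obtain ⟨n₀, hn₀⟩ := Metric.cauchySeq_iff'.1 hc 1 one_pos
  have h1 := hn₀ (n₀ + 1) (by omega)
  have h2 := hsep (hφ.injective.ne (show n₀ + 1 ≠ n₀ by omega))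
  rw [dist_eq_norm, hfu, hfu] at h1
  exact absurd h1 (not_lt.2 h2)

/-- A nonzero element orthogonal to all eigenspaces up to `c` has Rayleigh quotient above `c`. -/
theorem eq_zero_of_orthogonal (h : IsSpectralForm ι a) {c : ℝ} {u : V}
    (hu : ∀ w ∈ formEigensum ι a c, inner ℝ (ι w) (ι u) = 0) (hc : a u u ≤ c * ‖ι u‖ ^ 2) :
    u = 0 := by
  by_contra hu0
  have := h.finiteDimensional c
  -- A minimiser of the Rayleigh quotient on this complement will be an eigenvector of eigenvalue at
  -- most c, hence orthogonal to itself.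
  let W : Submodule ℝ V := ((formEigensum ι a c).map ι)ᗮ.comap ι
  have hW : ∀ v, v ∈ W ↔ ∀ w ∈ formEigensum ι a c, inner ℝ (ι w) (ι v) = 0 := by
    intro v
    simp only [W, Submodule.mem_comap, Submodule.mem_orthogonal, Submodule.mem_map]
    constructor
    · exact fun hv w hw => hv _ ⟨w, hw, rfl⟩
    · rintro hv _ ⟨w, hw, rfl⟩
      exact hv w hw
  have hnorm : ∀ v, v ≠ 0 → 0 < ‖ι v‖ := fun v hv =>
    norm_pos_iff.2 fun e => hv (h.injective (e.trans (map_zero ι).symm))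
  let S : Set ℝ := {r | ∃ v ∈ W, ‖ι v‖ = 1 ∧ a v v = r}
  have hSb : BddBelow S := ⟨0, by rintro _ ⟨v, _, _, rfl⟩; exact h.nonneg v⟩
  have hscale : ∀ v ∈ W, v ≠ 0 → a v v / ‖ι v‖ ^ 2 ∈ S := by
    intro v hv hv0
    have hp := hnorm v hv0
    refine ⟨‖ι v‖⁻¹ • v, W.smul_mem _ hv, ?_, ?_⟩
    · rw [map_smul, norm_smul, norm_inv, norm_norm, inv_mul_cancel₀ hp.ne']
    · simp only [map_smul, LinearMap.smul_apply, smul_eq_mul]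
      field_simp
  set m := sInf S with hm
  have hm0 : 0 ≤ m := Real.sInf_nonneg (by rintro _ ⟨v, _, _, rfl⟩; exact h.nonneg v)
  have hmin : ∀ v ∈ W, m * ‖ι v‖ ^ 2 ≤ a v v := by
    intro v hv
    by_cases hv0 : v = 0
    · simp [hv0]
    · rw [← le_div_iff₀ (pow_pos (hnorm v hv0) 2)]
      exact csInf_le hSb (hscale v hv hv0)
  have hmc : m ≤ c := (csInf_le hSb (hscale u ((hW u).2 hu) hu0)).trans
    ((div_le_iff₀ (pow_pos (hnorm u hu0) 2)).2 hc)
  have hne : S.Nonempty := ⟨_, hscale u ((hW u).2 hu) hu0⟩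
  have hex : ∀ n : ℕ, ∃ v ∈ W, ‖ι v‖ = 1 ∧ a v v < m + 1 / ((n : ℝ) + 1) := by
    intro n
    obtain ⟨_, ⟨v, hv, hv1, rfl⟩, hlt⟩ :=
      exists_lt_of_csInf_lt hne (lt_add_of_pos_right m (Nat.one_div_pos_of_nat (n := n)))
    exact ⟨v, hv, hv1, hlt⟩
  choose v hvW hv1 hva using hex
  obtain ⟨φ, hφ, hcau⟩ := h.compact v (m + 1) (fun n => by rw [hv1]; linarith)
    (fun n => (hva n).le.trans (by
      have : 1 / ((n : ℝ) + 1) ≤ 1 :=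
        (div_le_one (by positivity)).2 (by linarith [n.cast_nonneg (α := ℝ)])
      linarith))
  have hlim0 : Tendsto (fun n => 1 / ((φ n : ℝ) + 1)) atTop (𝓝 0) :=
    tendsto_one_div_add_atTop_nhds_zero_nat.comp hφ.tendsto_atTop
  obtain ⟨w, hw, haw⟩ := h.closed (fun n => v (φ n)) hcau (by
    intro ε hε
    -- The parallelogram law makes the minimising sequence Cauchy for the form: a(v - v') = 2a(v) +
    -- 2a(v') - a(v + v') < 4m + ε/2 - m(4 - δ²) < ε, using values below m + ε/8. The m + 1 in the
    -- choice of δ covers m = 0.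
    obtain ⟨δ, hδ, hδε⟩ : ∃ δ > 0, m * δ ^ 2 < ε / 2 := by
      refine ⟨Real.sqrt (ε / (2 * (m + 1)) / 2), by positivity, ?_⟩
      rw [Real.sq_sqrt (by positivity)]
      have : m * (ε / (2 * (m + 1)) / 2) = (m / (m + 1)) * (ε / 4) := by field_simp; ring
      rw [this]
      have : m / (m + 1) ≤ 1 := (div_le_one (by linarith)).2 (by linarith)
      nlinarith
    obtain ⟨n₁, hn₁⟩ := Metric.cauchySeq_iff.1 hcau δ hδ
    obtain ⟨n₂, hn₂⟩ := eventually_atTop.1 (hlim0.eventually_lt_const (show 0 < ε / 8 by linarith))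
    refine ⟨max n₁ n₂, fun n hn k hk => ?_⟩
    have hd := hn₁ n (le_of_max_le_left hn) k (le_of_max_le_left hk)
    rw [dist_eq_norm, ← map_sub] at hd
    have e1 := hn₂ n (le_of_max_le_right hn)
    have e2 := hn₂ k (le_of_max_le_right hk)
    have e3 := hva (φ n)
    have e4 := hva (φ k)
    have e5 := hmin _ (W.add_mem (hvW (φ n)) (hvW (φ k)))
    have e6 := parallelogram_law_with_norm ℝ (ι (v (φ n))) (ι (v (φ k)))
    rw [hv1, hv1, ← map_add, ← map_sub] at e6
    have e7 : ‖ι (v (φ n) - v (φ k))‖ ^ 2 ≤ δ ^ 2 := by gcongr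
    simp only [map_add, map_sub, LinearMap.add_apply, LinearMap.sub_apply,
      h.symm (v (φ k)) (v (φ n))] at e5 e6 e7 ⊢
    nlinarith [mul_le_mul_of_nonneg_left e7 hm0])
  have hw1 : ‖ι w‖ = 1 := by
    refine tendsto_nhds_unique hw.norm ?_
    simp only [hv1]
    exact tendsto_const_nhds
  have hwW : w ∈ W := by
    rw [hW]
    intro z hz
    refine tendsto_nhds_unique (tendsto_const_nhds.inner hw) ?_
    simp only [(hW _).1 (hvW _) z hz]
    exact tendsto_const_nhds
  have haw' : a w w = m := by
    refine tendsto_nhds_unique haw ?_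
    refine tendsto_of_tendsto_of_tendsto_of_le_of_le tendsto_const_nhds
      (by simpa using hlim0.const_add m) (fun n => ?_) (fun n => (hva (φ n)).le)
    simpa [hv1] using hmin _ (hvW (φ n))
  have hEL : ∀ ψ ∈ W, a w ψ = m * inner ℝ (ι w) (ι ψ) := by
    intro ψ hψ
    -- Minimality along w + tψ gives a nonnegative quadratic in t without constant term; its
    -- discriminant is a square, so the linear coefficient vanishes.
    have hq : ∀ t : ℝ, 0 ≤ (a ψ ψ - m * ‖ι ψ‖ ^ 2) * (t * t) +
        2 * (a w ψ - m * inner ℝ (ι w) (ι ψ)) * t + 0 := by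
      intro t
      have e := hmin _ (W.add_mem hwW (W.smul_mem t hψ))
      rw [← real_inner_self_eq_norm_sq] at e
      simp only [map_add, map_smul, LinearMap.add_apply, LinearMap.smul_apply, smul_eq_mul,
        inner_add_left, inner_add_right, real_inner_smul_left, real_inner_smul_right,
        h.symm ψ w, real_inner_comm (ι w) (ι ψ), haw'] at e
      rw [real_inner_self_eq_norm_sq, real_inner_self_eq_norm_sq, hw1] at e
      nlinarith
    have := discrim_le_zero hq
    simp only [discrim, mul_zero, sub_zero] at this
    have := pow_eq_zero_iff (two_ne_zero) |>.1 (le_antisymm this (sq_nonneg _))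
    linarith
  have hwE : w ∈ formEigenspace ι a m := by
    intro ψ
    -- The Euler–Lagrange equation extends from W to all of V: on the eigenspaces up to c both sides
    -- vanish, by orthogonality and symmetry of the form.
    obtain ⟨f, hf, hf'⟩ := exists_mem_orthogonal_sub ι (formEigensum ι a c) ψ
    have e1 := hEL _ ((hW _).2 hf')
    have e2 : inner ℝ (ι w) (ι f) = 0 := by
      rw [real_inner_comm]; exact (hW w).1 hwW f hf
    have e3 : a w f = 0 := by
      obtain ⟨g, hg, rfl⟩ := (Submodule.mem_iSup_iff_exists_finsupp _ _).1 hf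
      rw [Finsupp.sum, map_sum]
      refine Finset.sum_eq_zero fun i _ => ?_
      rw [h.symm, hg i w, (hW w).1 hwW _ (formEigenspace_le_formEigensum ι a i.2 (hg i)), mul_zero]
    simp only [map_sub, inner_sub_right, e2, e3, sub_zero] at e1
    exact e1
  have hwF := formEigenspace_le_formEigensum ι a hmc hwE
  have := (hW w).1 hwW w hwF
  rw [real_inner_self_eq_norm_sq, hw1] at this
  norm_num at this

/-- Minimax bound: a subspace on which the Rayleigh quotient is at most `c` has dimension at most
that of the sum of the eigenspaces up to `c`. -/
theorem finrank_le_finrank_formEigensum (h : IsSpectralForm ι a) {c : ℝ} (F : Submodule ℝ V)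
    [FiniteDimensional ℝ F] (hF : ∀ u ∈ F, a u u ≤ c * ‖ι u‖ ^ 2) :
    Module.finrank ℝ F ≤ Module.finrank ℝ (formEigensum ι a c) := by
  by_contra! hlt
  have := h.finiteDimensional c
  set K := (formEigensum ι a c).map ι
  have hK : Module.finrank ℝ K = Module.finrank ℝ (formEigensum ι a c) :=
    (Submodule.equivMapOfInjective ι h.injective _).symm.finrank_eq
  -- By dimension count this projection has a nonzero kernel vector: it is orthogonal to the
  -- eigenspaces up to c, yet its Rayleigh quotient is at most c.
  let P : F →ₗ[ℝ] K := K.orthogonalProjectionOnto.toLinearMap ∘ₗ ι ∘ₗ F.subtype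
  have hP : LinearMap.ker P ≠ ⊥ := P.ker_ne_bot_of_finrank_lt (by rwa [hK])
  obtain ⟨u, hu, hu0⟩ := Submodule.exists_mem_ne_zero_of_ne_bot hP
  have hu1 : ι u ∈ Kᗮ := (K.orthogonalProjectionOnto_eq_zero_iff).1 hu
  refine hu0 (Subtype.ext (h.eq_zero_of_orthogonal (c := c) (fun w hw => ?_) (hF u u.2)))
  exact (K.mem_orthogonal _).1 hu1 _ (Submodule.mem_map_of_mem hw)

theorem natCast_le_rank_iff (h : IsSpectralForm ι a) (j : ℕ) (t : ℝ) :
    (j : Cardinal) ≤ Module.rank ℝ (formEigensum ι a t) ↔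
      j ≤ Module.finrank ℝ (formEigensum ι a t) := by
  have := h.finiteDimensional t
  rw [← Module.finrank_eq_rank, Nat.cast_le]

theorem finrank_mono (h : IsSpectralForm ι a) :
    Monotone fun t => Module.finrank ℝ (formEigensum ι a t) := by
  intro s t hst
  have := h.finiteDimensional t
  exact Submodule.finrank_mono (formEigensum_mono ι a hst)

/-- Nonnegativity of the form excludes nonzero eigenvectors of negative eigenvalue. For j = 0 every
t would qualify, so j ≥ 1 is essential. -/
theorem bddBelow (h : IsSpectralForm ι a) {j : ℕ} (hj : 1 ≤ j) :
    ∀ t : ℝ, j ≤ Module.finrank ℝ (formEigensum ι a t) → 0 ≤ t := by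
  intro t ht
  by_contra! ht0
  have : formEigensum ι a t = ⊥ := by
    refine (Submodule.eq_bot_iff _).2 fun u hu => ?_
    by_contra hu0
    have hp : 0 < ‖ι u‖ := norm_pos_iff.2 fun e => hu0 (h.injective (e.trans (map_zero ι).symm))
    have h1 := h.form_le_of_mem hu
    have h2 := h.nonneg u
    nlinarith [pow_pos hp 2]
  rw [this, finrank_bot] at ht
  omega

theorem formEigenvalue_le (h : IsSpectralForm ι a) {j : ℕ} (hj : 1 ≤ j) {t : ℝ}
    (ht : j ≤ Module.finrank ℝ (formEigensum ι a t)) : formEigenvalue ι a j ≤ t :=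
  csInf_le ⟨0, fun s hs => h.bddBelow hj s ((h.natCast_le_rank_iff j s).1 hs)⟩
    ((h.natCast_le_rank_iff j t).2 ht)

theorem formEigenvalue_nonneg (h : IsSpectralForm ι a) {j : ℕ} (hj : 1 ≤ j) :
    0 ≤ formEigenvalue ι a j :=
  Real.sInf_nonneg fun s hs => h.bddBelow hj s ((h.natCast_le_rank_iff j s).1 hs)

theorem formEigenvalue_le_of_form_le (h : IsSpectralForm ι a) {j : ℕ} (hj : 1 ≤ j) {c : ℝ}
    (F : Submodule ℝ V) [FiniteDimensional ℝ F] (hjF : j ≤ Module.finrank ℝ F)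
    (hF : ∀ u ∈ F, a u u ≤ c * ‖ι u‖ ^ 2) : formEigenvalue ι a j ≤ c :=
  h.formEigenvalue_le hj (hjF.trans (h.finrank_le_finrank_formEigensum F hF))

variable (hinf : ∀ j : ℕ, ∃ F : Submodule ℝ V, FiniteDimensional ℝ F ∧ Module.finrank ℝ F = j)

include hinf in
-- Right continuity of the counting function: the infimum is attained. The hypothesis `hinf` keeps
-- the set under the infimum nonempty.
theorem le_finrank_formEigensum_formEigenvalue (h : IsSpectralForm ι a) (j : ℕ) :
    j ≤ Module.finrank ℝ (formEigensum ι a (formEigenvalue ι a j)) := by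
  rcases Nat.eq_zero_or_pos j with rfl | hj
  · exact Nat.zero_le _
  set m := formEigenvalue ι a j with hm
  let n : ℝ → ℕ := fun t => Module.finrank ℝ (formEigensum ι a t)
  have hn : ∀ t, m < t → j ≤ n t := by
    intro t ht
    have hne : {t : ℝ | (j : Cardinal) ≤ Module.rank ℝ (formEigensum ι a t)}.Nonempty := by
      obtain ⟨F, hF, hFj⟩ := hinf j
      obtain ⟨c, -, hc⟩ := exists_form_le_mul_norm_sq h.injective a F
      exact ⟨c, (h.natCast_le_rank_iff j c).2 (hFj ▸ h.finrank_le_finrank_formEigensum F hc)⟩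
    obtain ⟨s, hs, hst⟩ := exists_lt_of_csInf_lt hne ht
    exact ((h.natCast_le_rank_iff j s).1 hs).trans (h.finrank_mono hst.le)
  obtain ⟨t, ht, hmin⟩ : ∃ t, m < t ∧ ∀ s, m < s → n t ≤ n s := by
    have hne : (n '' Ioi m).Nonempty := ⟨_, m + 1, by simp, rfl⟩
    obtain ⟨t, ht, hnt⟩ := Nat.sInf_mem hne
    exact ⟨t, ht, fun s hs => hnt ▸ Nat.sInf_le ⟨s, hs, rfl⟩⟩
  have := h.finiteDimensional t
  refine (hn t ht).trans (h.finrank_le_finrank_formEigensum _ fun u hu => ?_)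
  have hle : ∀ s ∈ Ioo m t, a u u ≤ s * ‖ι u‖ ^ 2 := by
    intro s hs
    have : formEigensum ι a s = formEigensum ι a t :=
      Submodule.eq_of_le_of_finrank_le (formEigensum_mono ι a hs.2.le) (hmin s hs.1)
    exact h.form_le_of_mem (this ▸ hu)
  have hlim : Tendsto (fun s : ℝ => s * ‖ι u‖ ^ 2) (𝓝[>] m) (𝓝 (m * ‖ι u‖ ^ 2)) :=
    ((continuous_id.mul continuous_const).tendsto m).mono_left nhdsWithin_le_nhds
  exact ge_of_tendsto hlim (by filter_upwards [Ioo_mem_nhdsGT ht] with s hs using hle s hs)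

include hinf in
theorem formEigenvalue_le_iff (h : IsSpectralForm ι a) {j : ℕ} (hj : 1 ≤ j) {t : ℝ} :
    formEigenvalue ι a j ≤ t ↔ j ≤ Module.finrank ℝ (formEigensum ι a t) :=
  ⟨fun ht => (h.le_finrank_formEigensum_formEigenvalue hinf j).trans (h.finrank_mono ht),
    h.formEigenvalue_le hj⟩

include hinf in
theorem formEigenvalue_mono (h : IsSpectralForm ι a) {j k : ℕ} (hj : 1 ≤ j) (hjk : j ≤ k) :
    formEigenvalue ι a j ≤ formEigenvalue ι a k :=
  h.formEigenvalue_le hj (hjk.trans (h.le_finrank_formEigensum_formEigenvalue hinf k))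

include hinf in
theorem tendsto_formEigenvalue (h : IsSpectralForm ι a) :
    Tendsto (formEigenvalue ι a) atTop atTop := by
  refine tendsto_atTop.2 fun t => ?_
  filter_upwards [eventually_gt_atTop (Module.finrank ℝ (formEigensum ι a t))] with j hj
  by_contra! hlt
  exact absurd ((h.formEigenvalue_le_iff hinf (by omega)).1 hlt.le) (by omega)

theorem finite_formEigenspace (h : IsSpectralForm ι a) (t : ℝ) :
    Module.Finite ℝ (formEigenspace ι a t) := by
  have := h.finiteDimensional t
  exact Submodule.finiteDimensional_of_le (formEigenspace_le_formEigensum ι a le_rfl)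

include hinf in
theorem finrank_formEigenspace (h : IsSpectralForm ι a) (t : ℝ) :
    Module.finrank ℝ (formEigenspace ι a t) =
      Set.ncard {j : ℕ | 1 ≤ j ∧ formEigenvalue ι a j = t} := by
  have := h.finiteDimensional t
  have := h.finite_formEigenspace t
  let n : ℝ → ℕ := fun t => Module.finrank ℝ (formEigensum ι a t)
  -- The counting function is constant on [s₀, t), so its jump at t is the dimension of the
  -- eigenspace, and the indices of eigenvalue t are those in (n s₀, n t].
  obtain ⟨s₀, hs₀, hmax⟩ : ∃ s₀, s₀ < t ∧ ∀ s, s < t → n s ≤ n s₀ := by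
    have hne : (n '' Iio t).Nonempty := ⟨_, t - 1, by simp, rfl⟩
    have hb : BddAbove (n '' Iio t) :=
      ⟨n t, by rintro _ ⟨s, hs, rfl⟩; exact h.finrank_mono (le_of_lt hs)⟩
    obtain ⟨s₀, hs₀, hn⟩ := Nat.sSup_mem hne hb
    exact ⟨s₀, hs₀, fun s hs => hn ▸ le_csSup hb ⟨s, hs, rfl⟩⟩
  have := h.finiteDimensional s₀
  have hall : ∀ s, s < t → formEigensum ι a s ≤ formEigensum ι a s₀ := by
    intro s hs
    have := h.finiteDimensional (max s s₀)
    have e : formEigensum ι a s₀ = formEigensum ι a (max s s₀) :=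
      Submodule.eq_of_le_of_finrank_le (formEigensum_mono ι a (le_max_right _ _))
        (hmax _ (max_lt hs hs₀))
    rw [e]
    exact formEigensum_mono ι a (le_max_left _ _)
  have hsup : formEigensum ι a s₀ ⊔ formEigenspace ι a t = formEigensum ι a t := by
    refine le_antisymm (sup_le (formEigensum_mono ι a hs₀.le)
      (formEigenspace_le_formEigensum ι a le_rfl)) (iSup_le fun r => ?_)
    rcases lt_or_eq_of_le (show (r : ℝ) ≤ t from r.2) with hr | hr
    · exact ((formEigenspace_le_formEigensum ι a le_rfl).trans (hall r hr)).trans le_sup_left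
    · rw [hr]
      exact le_sup_right
  have hinf' : formEigensum ι a s₀ ⊓ formEigenspace ι a t = ⊥ := by
    refine (Submodule.eq_bot_iff _).2 fun u hu => ?_
    have h1 := h.form_le_of_mem hu.1
    have h2 := hu.2 u
    rw [real_inner_self_eq_norm_sq] at h2
    by_contra hu0
    have hp : 0 < ‖ι u‖ := norm_pos_iff.2 fun e => hu0 (h.injective (e.trans (map_zero ι).symm))
    nlinarith [pow_pos hp 2]
  have hdim := Submodule.finrank_sup_add_finrank_inf_eq (formEigensum ι a s₀)
    (formEigenspace ι a t)
  rw [hsup, hinf', finrank_bot, add_zero] at hdim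
  have hset : {j : ℕ | 1 ≤ j ∧ formEigenvalue ι a j = t} = Ioc (n s₀) (n t) := by
    ext j
    constructor
    · rintro ⟨hj, rfl⟩
      refine ⟨?_, (h.formEigenvalue_le_iff hinf hj).1 le_rfl⟩
      by_contra! hle
      exact absurd ((h.formEigenvalue_le_iff hinf hj).2 hle) (not_le.2 hs₀)
    · rintro ⟨hj1, hj2⟩
      have hj : 1 ≤ j := by omega
      refine ⟨hj, le_antisymm ((h.formEigenvalue_le_iff hinf hj).2 hj2) ?_⟩
      by_contra! hlt
      have e1 := (h.formEigenvalue_le_iff hinf hj).1 le_rfl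
      have e2 := hmax _ hlt
      exact absurd (e1.trans e2) (by omega)
  rw [hset, ← Finset.coe_Ioc, Set.ncard_coe_finset, Nat.card_Ioc]
  simp only [n]
  omega

end IsSpectralForm

end AbstractForm

/-! ### Rellich compactness through inward translations -/

section Rellich

variable {N : ℕ}

/-- A smooth function whose support is a compact subset of `D`. -/
structure IsTestFunction (D : Set (Euc N)) (φ : Euc N → ℝ) : Prop where
  contDiff : ContDiff ℝ ∞ φ
  hasCompactSupport : HasCompactSupport φ
  tsupport_subset : tsupport φ ⊆ D

theorem IsTestFunction.memLp {D : Set (Euc N)} {φ : Euc N → ℝ} (hφ : IsTestFunction D φ)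
    (μ : Measure (Euc N)) [IsFiniteMeasureOnCompacts μ] : MemLp φ 2 μ :=
  hφ.contDiff.continuous.memLp_of_hasCompactSupport hφ.hasCompactSupport

theorem IsTestFunction.eq_zero_of_notMem {D : Set (Euc N)} {φ : Euc N → ℝ}
    (hφ : IsTestFunction D φ) {x : Euc N} (hx : x ∉ D) : φ x = 0 :=
  image_eq_zero_of_notMem_tsupport fun h => hx (hφ.tsupport_subset h)

/-- Test functions supported in `D`, as a subspace of `L²(D)`. -/
def testSubmodule (D : Set (Euc N)) : Submodule ℝ (L2 D) where
  carrier := {p | ∃ φ, IsTestFunction D φ ∧ p =ᵐ[volume.restrict D] φ}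
  add_mem' := by
    rintro p q ⟨φ, hφ, hp⟩ ⟨ψ, hψ, hq⟩
    refine ⟨φ + ψ, ⟨hφ.contDiff.add hψ.contDiff, hφ.hasCompactSupport.add hψ.hasCompactSupport,
      (tsupport_add φ ψ).trans (union_subset hφ.tsupport_subset hψ.tsupport_subset)⟩, ?_⟩
    exact (Lp.coeFn_add p q).trans (hp.add hq)
  zero_mem' := ⟨0, ⟨contDiff_const, HasCompactSupport.zero, by simp [tsupport]⟩,
    Lp.coeFn_zero _ _ _⟩
  smul_mem' := by
    rintro c p ⟨φ, hφ, hp⟩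
    refine ⟨c • φ, ⟨contDiff_const.smul hφ.contDiff, hφ.hasCompactSupport.smul_left,
      (tsupport_smul_subset_right (fun _ => c) φ).trans hφ.tsupport_subset⟩, ?_⟩
    exact (Lp.coeFn_smul c p).trans (hp.const_smul c)

/-- An element orthogonal to all test functions vanishes almost everywhere, by the fundamental lemma
of the calculus of variations. -/
theorem dense_testSubmodule {D : Set (Euc N)} (hD : IsOpen D) :
    Dense (testSubmodule D : Set (L2 D)) := by
  rw [Submodule.dense_iff_topologicalClosure_eq_top, Submodule.topologicalClosure_eq_top_iff,
    Submodule.eq_bot_iff]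
  intro g hg
  have hsub : ∀ᵐ x ∂(volume.restrict D), x ∈ D → g x = 0 := by
    refine hD.ae_eq_zero_of_integral_contDiff_smul_eq_zero ?_ fun φ hφ hc hs => ?_
    · exact ((Lp.memLp g).locallyIntegrable (by norm_num)).locallyIntegrableOn D
    · have hφ' : IsTestFunction D φ := ⟨hφ, hc, hs⟩
      have h1 := (Submodule.mem_orthogonal _ _).1 hg ((hφ'.memLp (volume.restrict D)).toLp φ)
        ⟨φ, hφ', MemLp.coeFn_toLp _⟩
      rw [← SobolevH2.integral_mul_eq_inner] at h1
      rw [← h1]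
      refine integral_congr_ae ?_
      filter_upwards [(hφ'.memLp (volume.restrict D)).coeFn_toLp] with x hx
      rw [hx, smul_eq_mul]
  apply Lp.ext
  filter_upwards [hsub, ae_restrict_mem hD.measurableSet, Lp.coeFn_zero ℝ 2 (volume.restrict D)]
    with x hx hm h0
  rw [hx hm, h0, Pi.zero_apply]

/-- The `L²(D)` norm is detected by test functions. -/
theorem norm_le_of_forall_test {D : Set (Euc N)} (hD : IsOpen D) (f : L2 D) {C : ℝ} (hC : 0 ≤ C)
    (h : ∀ φ, IsTestFunction D φ →
      ∫ x in D, f x * φ x ≤ C * (eLpNorm φ 2 (volume.restrict D)).toReal) : ‖f‖ ≤ C := by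
  have key : ∀ p : L2 D, inner ℝ f p ≤ C * ‖p‖ := by
    have hcl : IsClosed {p : L2 D | inner ℝ f p ≤ C * ‖p‖} :=
      isClosed_le (by fun_prop) (by fun_prop)
    intro p
    refine hcl.closure_subset_iff.2 ?_ (dense_testSubmodule hD p)
    rintro q ⟨φ, hφ, hq⟩
    rw [mem_ofPred_eq, ← SobolevH2.integral_mul_eq_inner, Lp.norm_def, eLpNorm_congr_ae hq]
    refine le_trans (le_of_eq (integral_congr_ae ?_)) (h φ hφ)
    filter_upwards [hq] with x hx
    rw [hx]
  have h1 := key f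
  rw [real_inner_self_eq_norm_sq] at h1
  by_contra! hlt
  nlinarith

theorem isFiniteMeasure_restrict_of_isBounded {Ω : Set (Euc N)} (hb : Bornology.IsBounded Ω) :
    IsFiniteMeasure (volume.restrict Ω) :=
  MeasureTheory.isFiniteMeasure_restrict.2 hb.measure_lt_top.ne

theorem integral_mul_eq_inner_toLp {Ω : Set (Euc N)} (G : L2 Ω) {ψ : Euc N → ℝ}
    (hψ : MemLp ψ 2 (volume.restrict Ω)) :
    ∫ x in Ω, G x * ψ x = inner ℝ G (hψ.toLp ψ) := by
  rw [← SobolevH2.integral_mul_eq_inner]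
  refine integral_congr_ae ?_
  filter_upwards [hψ.coeFn_toLp] with x hx
  rw [hx]

theorem abs_integral_mul_le {Ω : Set (Euc N)} (G : L2 Ω) {ψ : Euc N → ℝ}
    (hψ : MemLp ψ 2 (volume.restrict Ω)) :
    |∫ x in Ω, G x * ψ x| ≤ ‖G‖ * (eLpNorm ψ 2 (volume.restrict Ω)).toReal := by
  rw [integral_mul_eq_inner_toLp G hψ, ← Lp.norm_toLp ψ hψ]
  exact abs_real_inner_le_norm _ _

/-- Weak directional derivatives control translations. -/
theorem abs_integral_translate_sub_le {Ω D : Set (Euc N)} (hb : Bornology.IsBounded Ω)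
    {u G : L2 Ω} {z : Euc N}
    (hG : ∀ φ, IsTestFunction Ω φ → ∫ x in Ω, u x * fderiv ℝ φ x z = -∫ x in Ω, G x * φ x)
    (hz : ∀ x ∈ D, ∀ s ∈ Icc (0 : ℝ) 1, x - s • z ∈ Ω) {φ : Euc N → ℝ} (hφ : IsTestFunction D φ) :
    |(∫ y in Ω, u y * φ (y + z)) - ∫ y in Ω, u y * φ y| ≤ ‖G‖ * (eLpNorm φ 2 volume).toReal := by
  have := isFiniteMeasure_restrict_of_isBounded hb
  have hu : Integrable (fun x => u x) (volume.restrict Ω) :=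
    (Lp.memLp u).integrable (by norm_num)
  have hsm : ∀ s : ℝ, ContDiff ℝ ∞ fun y => φ (y + s • z) := fun s =>
    hφ.contDiff.comp (contDiff_id.add contDiff_const)
  have hcs : ∀ s : ℝ, HasCompactSupport fun y => φ (y + s • z) := fun s =>
    hφ.hasCompactSupport.comp_homeomorph (Homeomorph.addRight (s • z))
  have htest : ∀ s ∈ Icc (0 : ℝ) 1, IsTestFunction Ω fun y => φ (y + s • z) := by
    intro s hs
    refine ⟨hsm s, hcs s, fun y hy => ?_⟩
    have h1 := hφ.tsupport_subset
      (tsupport_comp_subset_preimage φ (f := fun y => y + s • z) (by fun_prop) hy)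
    simpa using hz _ h1 s hs
  have hfd : Continuous fun x => fderiv ℝ φ x z :=
    (hφ.contDiff.continuous_fderiv (by simp)).clm_apply continuous_const
  obtain ⟨C, hC⟩ := (hφ.hasCompactSupport.fderiv_apply ℝ z).exists_bound_of_continuous hfd
  -- The translation acts on the smooth φ, so the derivative in s passes under the integral without
  -- differentiating u. The weak derivative then bounds it, and the mean value inequality on [0, 1]
  -- finishes.
  have hder : ∀ s : ℝ, HasDerivAt (fun s : ℝ => ∫ y in Ω, u y * φ (y + s • z))
      (∫ y in Ω, u y * fderiv ℝ φ (y + s • z) z) s := by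
    intro s
    refine (hasDerivAt_integral_of_dominated_loc_of_deriv_le (s := univ)
      (F := fun s y => u y * φ (y + s • z)) (F' := fun s y => u y * fderiv ℝ φ (y + s • z) z)
      (bound := fun y => ‖u y‖ * C) univ_mem ?_ ?_ ?_ ?_ ?_ ?_).2
    · exact .of_forall fun s => hu.aestronglyMeasurable.mul
        (hsm s).continuous.aestronglyMeasurable
    · exact integrable_mul_of_hasCompactSupport u (hsm s).continuous (hcs s)
    · exact hu.aestronglyMeasurable.mul
        (hfd.comp (continuous_add_const (s • z))).aestronglyMeasurable
    · refine .of_forall fun y s _ => ?_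
      rw [norm_mul]
      exact mul_le_mul_of_nonneg_left (hC _) (norm_nonneg _)
    · exact hu.norm.mul_const C
    · refine .of_forall fun y s _ => ?_
      have h1 : HasDerivAt (fun s : ℝ => y + s • z) z s := by
        simpa using ((hasDerivAt_id s).smul_const z).const_add y
      have h2 := (hφ.contDiff.differentiable (by simp) (y + s • z)).hasFDerivAt
      exact (h2.comp_hasDerivAt s h1).const_mul _
  have hbound : ∀ s ∈ Icc (0 : ℝ) 1, ‖∫ y in Ω, u y * fderiv ℝ φ (y + s • z) z‖ ≤
      ‖G‖ * (eLpNorm φ 2 volume).toReal := by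
    intro s hs
    have h1 := hG _ (htest s hs)
    simp only [fderiv_comp_add_right] at h1
    rw [h1, norm_neg]
    refine (abs_integral_mul_le G ((htest s hs).memLp _)).trans
      (mul_le_mul_of_nonneg_left ?_ (norm_nonneg _))
    refine ENNReal.toReal_mono (hφ.memLp volume).eLpNorm_ne_top
      ((eLpNorm_mono_measure _ Measure.restrict_le_self).trans (le_of_eq ?_))
    exact eLpNorm_comp_measurePreserving hφ.contDiff.continuous.aestronglyMeasurable
      (measurePreserving_add_right volume (s • z))
  have := (convex_Icc (0 : ℝ) 1).norm_image_sub_le_of_norm_hasDerivWithin_le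
    (fun s _ => (hder s).hasDerivWithinAt) hbound (left_mem_Icc.2 zero_le_one)
    (right_mem_Icc.2 zero_le_one)
  simpa using this

/-- The integral of `u` over `(x - Z) ∩ Ω`. -/
def slidingIntegral {Ω : Set (Euc N)} (Z : Set (Euc N)) (u : L2 Ω) (x : Euc N) : ℝ :=
  ∫ y in Ω, u y * Z.indicator (fun _ => (1 : ℝ)) (x - y)

/-- Tested against φ, the sliding integral is the integral over z ∈ Z of the translated pairings, by
Fubini and x = y + z. Each of these differs from the untranslated pairing by at most K. -/
theorem abs_integral_slidingIntegral_sub_le {Ω Z : Set (Euc N)} (hb : Bornology.IsBounded Ω)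
    (hZ : MeasurableSet Z) (hZf : volume Z ≠ ⊤) (u : L2 Ω) {D : Set (Euc N)} {φ : Euc N → ℝ}
    (hφ : IsTestFunction D φ) {K : ℝ}
    (hK : ∀ z ∈ Z, |(∫ y in Ω, u y * φ (y + z)) - ∫ y in Ω, u y * φ y| ≤ K) :
    |(∫ x, slidingIntegral Z u x * φ x) - volume.real Z * ∫ y in Ω, u y * φ y| ≤
      K * volume.real Z := by
  have := isFiniteMeasure_restrict_of_isBounded hb
  have : IsFiniteMeasure (volume.restrict Z) := MeasureTheory.isFiniteMeasure_restrict.2 hZf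
  have hu : Integrable (fun x => u x) (volume.restrict Ω) :=
    (Lp.memLp u).integrable (by norm_num)
  have hφi : Integrable φ := hφ.contDiff.continuous.integrable_of_hasCompactSupport
    hφ.hasCompactSupport
  obtain ⟨C, hC⟩ := hφ.hasCompactSupport.exists_bound_of_continuous hφ.contDiff.continuous
  have hI1 : Integrable (Function.uncurry fun y z => u y * φ (y + z))
      ((volume.restrict Ω).prod (volume.restrict Z)) := by
    refine (hu.comp_fst (volume.restrict Z)).mul_bdd (c := C) ?_ (.of_forall fun p => hC _)
    exact (hφ.contDiff.continuous.comp (continuous_fst.add continuous_snd)).aestronglyMeasurable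
  have hI2 : Integrable (Function.uncurry fun y x => u y * φ x *
      Z.indicator (fun _ => (1 : ℝ)) (x - y)) ((volume.restrict Ω).prod volume) := by
    refine (hu.mul_prod hφi).mul_bdd (c := 1) ?_ (.of_forall fun p => ?_)
    · exact ((measurable_const.indicator hZ).comp
        (measurable_snd.sub measurable_fst)).aestronglyMeasurable
    · refine (norm_indicator_le_norm_self _ _).trans (by simp)
  have e1 : ∫ x, slidingIntegral Z u x * φ x = ∫ z in Z, ∫ y in Ω, u y * φ (y + z) := by
    rw [← integral_integral_swap hI1]
    have : ∀ y, ∫ z in Z, u y * φ (y + z) =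
        ∫ x, u y * φ x * Z.indicator (fun _ => (1 : ℝ)) (x - y) := by
      intro y
      rw [← integral_indicator hZ, ← integral_add_left_eq_self (μ := volume)
        (fun x => u y * φ x * Z.indicator (fun _ => (1 : ℝ)) (x - y)) y]
      refine integral_congr_ae (.of_forall fun z => ?_)
      by_cases hz : z ∈ Z <;> simp [hz]
    simp only [this]
    rw [integral_integral_swap hI2]
    refine integral_congr_ae (.of_forall fun x => ?_)
    simp only [slidingIntegral]
    rw [← integral_mul_const]
    refine integral_congr_ae (.of_forall fun y => ?_)
    ring
  have hI3 : IntegrableOn (fun z => ∫ y in Ω, u y * φ (y + z)) Z := hI1.integral_prod_right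
  have e2 : volume.real Z * ∫ y in Ω, u y * φ y = ∫ z in Z, ∫ y in Ω, u y * φ y := by simp
  rw [e1, e2, ← integral_sub hI3 (integrable_const _)]
  exact norm_setIntegral_le_of_norm_le_const (f := fun z =>
    (∫ y in Ω, u y * φ (y + z)) - ∫ y in Ω, u y * φ y) hZf.lt_top hK

theorem integral_mul_fderiv_of_isWeakPartial {Ω : Set (Euc N)} {u : L2 Ω} {g : Fin N → L2 Ω}
    (hg : ∀ i, IsWeakPartial Ω i u (g i)) (z : Euc N) {φ : Euc N → ℝ} (hφ : IsTestFunction Ω φ) :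
    ∫ x in Ω, u x * fderiv ℝ φ x z = -∫ x in Ω, (∑ i, z i • g i : L2 Ω) x * φ x := by
  have hz : z = ∑ i, z i • EuclideanSpace.single i (1 : ℝ) := by
    ext j
    simp [Finset.sum_apply, Pi.single_apply]
  have h1 : ∀ x, u x * fderiv ℝ φ x z =
      ∑ i, z i * (u x * fderiv ℝ φ x (EuclideanSpace.single i 1)) := by
    intro x
    conv_lhs => rw [hz, map_sum, Finset.mul_sum]
    refine Finset.sum_congr rfl fun i _ => ?_
    rw [map_smul, smul_eq_mul]
    ring
  simp only [h1]
  rw [integral_finsetSum _ fun i _ => (integrable_mul_of_hasCompactSupport u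
    (continuous_partial hφ.contDiff i) (hφ.hasCompactSupport.fderiv_apply ℝ _)).const_mul _,
    integral_mul_eq_inner_toLp _ (hφ.memLp _), sum_inner, ← Finset.sum_neg_distrib]
  refine Finset.sum_congr rfl fun i _ => ?_
  rw [integral_const_mul, hg i φ hφ.contDiff hφ.hasCompactSupport hφ.tsupport_subset,
    real_inner_smul_left, ← integral_mul_eq_inner_toLp _ (hφ.memLp _)]
  ring

theorem norm_sum_smul_le {Ω : Set (Euc N)} {g : Fin N → L2 Ω} {R ε : ℝ}
    (hg : ∀ i, ‖g i‖ ≤ R) {z : Euc N} (hz : ‖z‖ ≤ ε) : ‖∑ i, z i • g i‖ ≤ N * (ε * R) := by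
  refine (norm_sum_le _ _).trans ((Finset.sum_le_card_nsmul _ _ (ε * R) fun i _ => ?_).trans ?_)
  · rw [norm_smul]
    exact mul_le_mul ((PiLp.norm_apply_le z i).trans hz) (hg i) (norm_nonneg _)
      ((norm_nonneg z).trans hz)
  · simp

theorem tendsto_eLpNorm_two_zero {X ι : Type*} [MeasurableSpace X] {μ : Measure X}
    [IsFiniteMeasure μ] {l : Filter ι} [l.IsCountablyGenerated] {F : ι → X → ℝ} {C : ℝ}
    (hF : ∀ i, Measurable (F i)) (hC : ∀ i x, ‖F i x‖ ≤ C)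
    (hlim : ∀ x, Tendsto (fun i => F i x) l (𝓝 0)) :
    Tendsto (fun i => eLpNorm (F i) 2 μ) l (𝓝 0) := by
  have h1 : Tendsto (fun i => ∫⁻ x, ‖F i x‖ₑ ^ (2 : ℝ) ∂μ) l (𝓝 (∫⁻ _, 0 ∂μ)) := by
    refine tendsto_lintegral_filter_of_dominated_convergence
      (fun _ => (ENNReal.ofReal C) ^ (2 : ℝ)) (.of_forall fun i => by fun_prop)
      (.of_forall fun i => .of_forall fun x => ?_) ?_ (.of_forall fun x => ?_)
    · refine ENNReal.rpow_le_rpow ?_ (by norm_num)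
      rw [← ofReal_norm]
      exact ENNReal.ofReal_le_ofReal (hC i x)
    · rw [lintegral_const]
      exact ENNReal.mul_ne_top (by simp) (measure_ne_top _ _)
    · have h2 : Tendsto (fun i => ‖F i x‖ₑ) l (𝓝 0) := by simpa using (hlim x).enorm
      simpa [Function.comp_def] using
        ((ENNReal.continuous_rpow_const (y := 2)).tendsto 0).comp h2
  rw [lintegral_zero] at h1
  simp only [eLpNorm_eq_lintegral_rpow_enorm_toReal two_ne_zero ENNReal.ofNat_ne_top]
  simpa [Function.comp_def] using
    ((ENNReal.continuous_rpow_const (y := 1 / (2 : ℝ))).tendsto 0).comp h1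

/-- There are sets of positive measure of arbitrarily small vectors by which one can translate
`D` backwards inside `Ω`. -/
def HasInwardTranslations (Ω D : Set (Euc N)) : Prop :=
  ∀ ε > 0, ∃ Z : Set (Euc N), MeasurableSet Z ∧ volume Z ≠ 0 ∧ volume Z ≠ ⊤ ∧
    ∀ z ∈ Z, ‖z‖ ≤ ε ∧ ∀ x ∈ D, ∀ s ∈ Icc (0 : ℝ) 1, x - s • z ∈ Ω

theorem memLp_slidingKernel {Ω Z : Set (Euc N)} (hb : Bornology.IsBounded Ω)
    (hZ : MeasurableSet Z) (x : Euc N) :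
    MemLp (fun y => Z.indicator (fun _ => (1 : ℝ)) (x - y)) 2 (volume.restrict Ω) := by
  have := isFiniteMeasure_restrict_of_isBounded hb
  refine MemLp.of_bound (C := 1) ((measurable_const.indicator hZ).comp
    (measurable_const.sub measurable_id)).aestronglyMeasurable (.of_forall fun y => ?_)
  exact (norm_indicator_le_norm_self _ _).trans (by simp)

theorem measurable_slidingIntegral {Ω Z : Set (Euc N)} (hb : Bornology.IsBounded Ω)
    (hZ : MeasurableSet Z) (u : L2 Ω) : Measurable (slidingIntegral Z u) := by
  have := isFiniteMeasure_restrict_of_isBounded hb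
  refine (StronglyMeasurable.integral_prod_right
    (f := fun x y => u y * Z.indicator (fun _ => (1 : ℝ)) (x - y)) ?_).measurable
  exact ((Lp.stronglyMeasurable u).comp_measurable measurable_snd).mul
    ((measurable_const.indicator hZ).comp
      (measurable_fst.sub measurable_snd)).stronglyMeasurable

theorem norm_slidingIntegral_le {Ω Z : Set (Euc N)} (hb : Bornology.IsBounded Ω)
    (hZ : MeasurableSet Z) (u : L2 Ω) (x : Euc N) :
    ‖slidingIntegral Z u x‖ ≤
      ‖u‖ * (eLpNorm (fun _ : Euc N => (1 : ℝ)) 2 (volume.restrict Ω)).toReal := by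
  have := isFiniteMeasure_restrict_of_isBounded hb
  refine (abs_integral_mul_le u (memLp_slidingKernel hb hZ x)).trans
    (mul_le_mul_of_nonneg_left ?_ (norm_nonneg _))
  refine ENNReal.toReal_mono (memLp_const 1).eLpNorm_ne_top (eLpNorm_mono fun y => ?_)
  exact norm_indicator_le_norm_self (fun _ => (1 : ℝ)) (x - y)

/-- A function is close in `L²(D)` to its average over a set of small inward translations. -/
theorem eLpNorm_le_add_eLpNorm_slidingIntegral {Ω D Z : Set (Euc N)}
    (hb : Bornology.IsBounded Ω) (hD : IsOpen D) (hDΩ : D ⊆ Ω) {ε R : ℝ} (hε : 0 ≤ ε)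
    (hR : 0 ≤ R) (hZ : MeasurableSet Z) (hZ0 : volume Z ≠ 0) (hZf : volume Z ≠ ⊤)
    (hz : ∀ z ∈ Z, ‖z‖ ≤ ε ∧ ∀ x ∈ D, ∀ s ∈ Icc (0 : ℝ) 1, x - s • z ∈ Ω)
    {u : L2 Ω} {g : Fin N → L2 Ω} (hu : ∀ i, IsWeakPartial Ω i u (g i)) (hg : ∀ i, ‖g i‖ ≤ R) :
    eLpNorm u 2 (volume.restrict D) ≤ ENNReal.ofReal (N * (ε * R)) +
      ‖(volume.real Z)⁻¹‖ₑ * eLpNorm (slidingIntegral Z u) 2 (volume.restrict D) := by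
  have := isFiniteMeasure_restrict_of_isBounded hb
  have := isFiniteMeasure_restrict_of_isBounded (hb.subset hDΩ)
  have hv : 0 < volume.real Z := ENNReal.toReal_pos hZ0 hZf
  set A := slidingIntegral Z u with hA
  have hu2 : MemLp u 2 (volume.restrict D) :=
    (Lp.memLp u).mono_measure (Measure.restrict_mono hDΩ le_rfl)
  have hA2 : MemLp A 2 (volume.restrict D) :=
    MemLp.of_bound (measurable_slidingIntegral hb hZ u).aestronglyMeasurable _
      (.of_forall fun x => norm_slidingIntegral_le hb hZ u x)
  have hf : MemLp ((u : Euc N → ℝ) - (volume.real Z)⁻¹ • A) 2 (volume.restrict D) :=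
    hu2.sub (hA2.const_smul _)
  have hnorm : ‖hf.toLp _‖ ≤ N * (ε * R) := by
    refine norm_le_of_forall_test hD _ (by positivity) fun φ hφ => ?_
    have hK : ∀ z ∈ Z, |(∫ y in Ω, u y * φ (y + z)) - ∫ y in Ω, u y * φ y| ≤
        N * (ε * R) * (eLpNorm φ 2 volume).toReal := by
      intro z hzZ
      refine (abs_integral_translate_sub_le hb (D := D)
        (fun φ hφ => integral_mul_fderiv_of_isWeakPartial hu z hφ) (hz z hzZ).2 hφ).trans ?_
      exact mul_le_mul_of_nonneg_right (norm_sum_smul_le hg (hz z hzZ).1) ENNReal.toReal_nonneg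
    have h1 := abs_integral_slidingIntegral_sub_le hb hZ hZf u hφ hK
    have hsupp : Function.support φ ⊆ D := (subset_tsupport φ).trans hφ.tsupport_subset
    rw [eLpNorm_restrict_eq_of_support_subset hsupp]
    have h2 : ∫ x in D, (hf.toLp _) x * φ x =
        (∫ x in D, u x * φ x) - (volume.real Z)⁻¹ * ∫ x in D, A x * φ x := by
      have i1 : Integrable (fun x => u x * φ x) (volume.restrict D) :=
        hu2.integrable_mul (q := 2) (hφ.memLp _)
      have i2 : Integrable (fun x => A x * φ x) (volume.restrict D) :=
        hA2.integrable_mul (q := 2) (hφ.memLp _)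
      rw [← integral_const_mul, ← integral_sub i1 (i2.const_mul _)]
      refine integral_congr_ae ?_
      filter_upwards [hf.coeFn_toLp] with x hx
      rw [hx]
      simp only [Pi.sub_apply, Pi.smul_apply, smul_eq_mul]
      ring
    have h3 : ∫ x in D, u x * φ x = ∫ x in Ω, u x * φ x := by
      rw [setIntegral_eq_integral_of_forall_compl_eq_zero fun x hx => by
          rw [hφ.eq_zero_of_notMem hx, mul_zero],
        setIntegral_eq_integral_of_forall_compl_eq_zero fun x hx => by
          rw [hφ.eq_zero_of_notMem fun h => hx (hDΩ h), mul_zero]]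
    have h4 : ∫ x in D, A x * φ x = ∫ x, A x * φ x :=
      setIntegral_eq_integral_of_forall_compl_eq_zero fun x hx => by
        rw [hφ.eq_zero_of_notMem hx, mul_zero]
    rw [h2, h3, h4]
    have h5 := (abs_le.1 h1).1
    have h6 : (volume.real Z)⁻¹ * volume.real Z = 1 := inv_mul_cancel₀ hv.ne'
    have h7 := mul_le_mul_of_nonneg_left h5 (inv_nonneg.2 hv.le)
    linear_combination h7 + (N * (ε * R) * (eLpNorm φ 2 volume).toReal - ∫ y in Ω, u y * φ y) * h6
  rw [Lp.norm_toLp] at hnorm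
  have h1 : eLpNorm ((u : Euc N → ℝ) - (volume.real Z)⁻¹ • A) 2 (volume.restrict D) ≤
      ENNReal.ofReal (N * (ε * R)) :=
    ENNReal.le_ofReal_iff_toReal_le hf.eLpNorm_ne_top (by positivity) |>.2 hnorm
  calc eLpNorm u 2 (volume.restrict D)
      = eLpNorm (((u : Euc N → ℝ) - (volume.real Z)⁻¹ • A) + (volume.real Z)⁻¹ • A) 2
          (volume.restrict D) := by rw [sub_add_cancel]
    _ ≤ _ := eLpNorm_add_le hf.aestronglyMeasurable (hA2.const_smul _).aestronglyMeasurable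
        (by norm_num)
    _ ≤ _ := by
      rw [eLpNorm_const_smul]
      gcongr

/-- Up to a small uniform error u is its average over translations. That average at x is a pairing
with a fixed L² kernel, so weak convergence makes it tend to 0 pointwise; it is also uniformly
bounded, so dominated convergence applies. -/
theorem tendsto_eLpNorm_of_hasInwardTranslations {Ω D : Set (Euc N)}
    (hb : Bornology.IsBounded Ω) (hD : IsOpen D) (hDΩ : D ⊆ Ω) (hT : HasInwardTranslations Ω D)
    {ι : Type*} {l : Filter ι} [l.IsCountablyGenerated] {u : ι → L2 Ω} {g : ι → Fin N → L2 Ω}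
    {R : ℝ} (hR : 0 ≤ R) (huR : ∀ n, ‖u n‖ ≤ R) (hgR : ∀ n i, ‖g n i‖ ≤ R)
    (hu : ∀ n i, IsWeakPartial Ω i (u n) (g n i))
    (hweak : ∀ p : L2 Ω, Tendsto (fun n => inner ℝ (u n) p) l (𝓝 0)) :
    Tendsto (fun n => eLpNorm (u n) 2 (volume.restrict D)) l (𝓝 0) := by
  have := isFiniteMeasure_restrict_of_isBounded hb
  have := isFiniteMeasure_restrict_of_isBounded (hb.subset hDΩ)
  rw [ENNReal.tendsto_nhds_zero]
  intro η hη
  obtain ⟨δ, hδ, hδη⟩ := ENNReal.lt_iff_exists_nnreal_btwn.1 (ENNReal.half_pos hη.ne')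
  have hδ' : (0 : ℝ) < δ := by exact_mod_cast hδ
  -- With this radius the averaging error N ε R is at most δ < η/2; the added 1 avoids division by
  -- zero.
  obtain ⟨Z, hZ, hZ0, hZf, hz⟩ := hT (δ / (N * R + 1)) (by positivity)
  have hA : Tendsto (fun n => ‖(volume.real Z)⁻¹‖ₑ *
      eLpNorm (slidingIntegral Z (u n)) 2 (volume.restrict D)) l (𝓝 0) := by
    have h1 : Tendsto (fun n => eLpNorm (slidingIntegral Z (u n)) 2 (volume.restrict D)) l
        (𝓝 0) := by
      refine tendsto_eLpNorm_two_zero (fun n => measurable_slidingIntegral hb hZ (u n))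
        (fun n x => (norm_slidingIntegral_le hb hZ (u n) x).trans
          (mul_le_mul_of_nonneg_right (huR n) ENNReal.toReal_nonneg)) fun x => ?_
      have h2 := hweak ((memLp_slidingKernel hb hZ x).toLp _)
      simp only [← integral_mul_eq_inner_toLp] at h2
      exact h2
    simpa using ENNReal.Tendsto.const_mul h1 (.inr (enorm_ne_top (x := (volume.real Z)⁻¹)))
  filter_upwards [ENNReal.tendsto_nhds_zero.1 hA (η / 2) (ENNReal.half_pos hη.ne')] with n hn
  refine (eLpNorm_le_add_eLpNorm_slidingIntegral hb hD hDΩ (by positivity) hR hZ hZ0 hZf hz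
    (hu n) (hgR n)).trans ?_
  rw [← ENNReal.add_halves η]
  refine add_le_add (le_trans ?_ hδη.le) hn
  rw [← ENNReal.ofReal_coe_nnreal]
  refine ENNReal.ofReal_le_ofReal ?_
  have : (N : ℝ) * (δ / (N * R + 1) * R) = δ * ((N * R) / (N * R + 1)) := by ring
  rw [this]
  exact mul_le_of_le_one_right hδ'.le ((div_le_one (by positivity)).2 (by linarith))

/-- Near each point of the closure of `Ω` one can translate into `Ω`. -/
def IsLocallyTranslatable (Ω : Set (Euc N)) : Prop :=
  ∀ x ∈ closure Ω, ∃ U : Set (Euc N), IsOpen U ∧ x ∈ U ∧ HasInwardTranslations Ω (U ∩ Ω)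

theorem tendsto_norm_of_isLocallyTranslatable {Ω : Set (Euc N)} (hΩ : IsOpen Ω)
    (hb : Bornology.IsBounded Ω) (hT : IsLocallyTranslatable Ω)
    {ι : Type*} {l : Filter ι} [l.IsCountablyGenerated] {u : ι → L2 Ω} {g : ι → Fin N → L2 Ω}
    {R : ℝ} (hR : 0 ≤ R) (huR : ∀ n, ‖u n‖ ≤ R) (hgR : ∀ n i, ‖g n i‖ ≤ R)
    (hu : ∀ n i, IsWeakPartial Ω i (u n) (g n i))
    (hweak : ∀ p : L2 Ω, Tendsto (fun n => inner ℝ (u n) p) l (𝓝 0)) :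
    Tendsto (fun n => ‖u n‖) l (𝓝 0) := by
  -- The squared L² mass is monotone and subadditive in the set, so its decay passes from
  -- neighbourhoods to the compact closure of Ω.
  let Q : Set (Euc N) → ι → ℝ≥0∞ := fun s n => ∫⁻ x in s ∩ Ω, ‖u n x‖ₑ ^ (2 : ℝ)
  have hcpt : IsCompact (closure Ω) := hb.isCompact_closure
  have key : Tendsto (Q (closure Ω)) l (𝓝 0) := by
    refine hcpt.induction_on (p := fun s => Tendsto (Q s) l (𝓝 0)) ?_ ?_ ?_ ?_
    · simpa [Q] using tendsto_const_nhds
    · intro s t hst ht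
      exact tendsto_of_tendsto_of_tendsto_of_le_of_le tendsto_const_nhds ht (fun _ => zero_le)
        fun n => lintegral_mono_set (inter_subset_inter_left _ hst)
    · intro s t hs ht
      have h1 := hs.add ht
      rw [add_zero] at h1
      refine tendsto_of_tendsto_of_tendsto_of_le_of_le tendsto_const_nhds h1 (fun _ => zero_le)
        fun n => ?_
      simp only [Q, union_inter_distrib_right]
      exact lintegral_union_le _ _ _
    · intro x hx
      obtain ⟨U, hU, hxU, hUT⟩ := hT x hx
      refine ⟨U, mem_nhdsWithin_of_mem_nhds (hU.mem_nhds hxU), ?_⟩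
      have h1 := tendsto_eLpNorm_of_hasInwardTranslations hb (hU.inter hΩ) inter_subset_right hUT
        hR huR hgR hu hweak
      have h2 := ((ENNReal.continuous_rpow_const (y := 2)).tendsto 0).comp h1
      rw [ENNReal.zero_rpow_of_pos (by norm_num)] at h2
      refine h2.congr fun n => ?_
      have h3 := eLpNorm_nnreal_pow_eq_lintegral (μ := volume.restrict (U ∩ Ω)) (f := u n)
        (p := 2) two_ne_zero
      exact h3
  have h1 : ∀ n, ‖u n‖ = ((Q (closure Ω) n) ^ (1 / (2 : ℝ))).toReal := by
    intro n
    rw [Lp.norm_def, eLpNorm_eq_lintegral_rpow_enorm_toReal two_ne_zero ENNReal.ofNat_ne_top]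
    simp [Q, inter_eq_self_of_subset_right (subset_closure (s := Ω))]
  have h2 := ((ENNReal.continuous_rpow_const (y := 1 / (2 : ℝ))).tendsto 0).comp key
  rw [ENNReal.zero_rpow_of_pos (by norm_num)] at h2
  have h3 := (ENNReal.tendsto_toReal ENNReal.zero_ne_top).comp h2
  simpa [Function.comp_def, h1] using h3

/-- **Rellich's theorem** for `H¹(Ω)`. -/
theorem exists_cauchySeq_of_bounded {Ω : Set (Euc N)} (hΩ : IsOpen Ω)
    (hb : Bornology.IsBounded Ω) (hT : IsLocallyTranslatable Ω) {u : ℕ → L2 Ω}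
    {g : ℕ → Fin N → L2 Ω} {R : ℝ} (huR : ∀ n, ‖u n‖ ≤ R)
    (hgR : ∀ n i, ‖g n i‖ ≤ R) (hu : ∀ n i, IsWeakPartial Ω i (u n) (g n i)) :
    ∃ φ : ℕ → ℕ, StrictMono φ ∧ CauchySeq fun n => u (φ n) := by
  have hR : 0 ≤ R := (norm_nonneg _).trans (huR 0)
  have : Fact ((2 : ℝ≥0∞) ≠ ⊤) := ⟨by norm_num⟩
  obtain ⟨p, -, φ, hφ, hlim⟩ := WeakDual.isSeqCompact_closedBall ℝ (L2 Ω) 0 R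
    (x := fun n => StrongDual.toWeakDual (InnerProductSpace.toDual ℝ (L2 Ω) (u n)))
    (fun n => by
      simp only [mem_preimage, mem_closedBall_zero_iff]
      exact ((InnerProductSpace.toDual ℝ (L2 Ω)).norm_map (u n)).le.trans (huR n))
  refine ⟨φ, hφ, ?_⟩
  have hweak : ∀ q : L2 Ω, Tendsto (fun n => inner ℝ (u (φ n)) q) atTop (𝓝 (p q)) := fun q =>
    (tendsto_iff_forall_eval_tendsto_topDualPairing.1 hlim) q
  rw [cauchySeq_iff_tendsto_dist_atTop_0]
  simp only [dist_eq_norm]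
  -- Applied to differences indexed by pairs, which tend weakly to 0; this gives the Cauchy property
  -- directly.
  refine tendsto_norm_of_isLocallyTranslatable hΩ hb hT (R := R + R) (add_nonneg hR hR)
    (g := fun n i => g (φ n.1) i + (-1 : ℝ) • g (φ n.2) i)
    (fun n => (norm_sub_le _ _).trans (add_le_add (huR _) (huR _)))
    (fun n i => ?_) (fun n i => ?_) fun q => ?_
  · rw [neg_one_smul, ← sub_eq_add_neg]
    exact (norm_sub_le _ _).trans (add_le_add (hgR _ _) (hgR _ _))
  · have := (hu (φ n.1) i).add ((hu (φ n.2) i).smul (-1))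
    rwa [neg_one_smul, ← sub_eq_add_neg] at this
  · rw [← prod_atTop_atTop_eq]
    simpa [inner_sub_left] using
      ((hweak q).comp tendsto_fst).sub ((hweak q).comp tendsto_snd)

/-- In the interior all short vectors work. At the boundary γ is C¹, hence locally Lipschitz, and Ω
lies below its graph, so one may move downwards along a cone steeper than the graph. -/
theorem isLocallyTranslatable {k : ℕ} {α : ℝ≥0} (hk : 1 ≤ k) {Ω : Set (Euc N)} (hΩ : IsOpen Ω)
    (hbd : HasHolderBoundary k α Ω) : IsLocallyTranslatable Ω := by
  intro x₀ hx₀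
  by_cases hx : x₀ ∈ Ω
  · obtain ⟨ρ, hρ, hρΩ⟩ := Metric.isOpen_iff.1 hΩ x₀ hx
    refine ⟨Metric.ball x₀ (ρ / 2), Metric.isOpen_ball, Metric.mem_ball_self (by positivity),
      fun ε hε => ⟨Metric.ball 0 (min ε (ρ / 2)), measurableSet_ball,
        (Metric.measure_ball_pos _ _ (by positivity)).ne', measure_ball_lt_top.ne,
        fun z hz => ?_⟩⟩
    rw [mem_ball_zero_iff, lt_min_iff] at hz
    refine ⟨hz.1.le, fun x hx s hs => hρΩ ?_⟩
    have h1 := hx.1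
    rw [Metric.mem_ball, dist_eq_norm] at h1 ⊢
    have h2 : ‖s • z‖ ≤ ‖z‖ := by
      rw [norm_smul, Real.norm_of_nonneg hs.1]
      exact mul_le_of_le_one_left (norm_nonneg _) hs.2
    calc ‖x - s • z - x₀‖ = ‖(x - x₀) - s • z‖ := by congr 1; abel
      _ ≤ ‖x - x₀‖ + ‖s • z‖ := norm_sub_le _ _
      _ < ρ := by linarith [hz.2]
  · have hfr : x₀ ∈ frontier Ω := by rw [hΩ.frontier_eq]; exact ⟨hx₀, hx⟩
    obtain ⟨e, U, γ, he, hU, hxU, hγ, -, hgraph⟩ := hbd x₀ hfr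
    set P := (ℝ ∙ e)ᗮ.orthogonalProjectionOnto with hP
    have hP1 : ∀ z, ‖P z‖ ≤ ‖z‖ := fun z => Submodule.norm_orthogonalProjectionOnto_apply_le _ z
    have hPe : P e = 0 := by
      rw [hP, Submodule.orthogonalProjectionOnto_eq_zero_iff, Submodule.orthogonal_orthogonal]
      exact Submodule.mem_span_singleton_self e
    obtain ⟨K, t, ht, hK⟩ := ((hγ.of_le (by exact_mod_cast hk) : ContDiff ℝ 1 γ).contDiffAt
      (x := P x₀)).exists_lipschitzOnWith
    obtain ⟨ρ₁, hρ₁, hρt⟩ := Metric.mem_nhds_iff.1 ht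
    obtain ⟨ρ₂, hρ₂, hρU⟩ := Metric.isOpen_iff.1 hU x₀ hxU
    -- Halved because both the point and its translation vector use up a distance ρ from the centre.
    set ρ := min ρ₁ ρ₂ / 2 with hρdef
    have hρ : 0 < ρ := by positivity
    have hρ1 : ρ + ρ ≤ ρ₁ := by rw [hρdef]; linarith [min_le_left ρ₁ ρ₂]
    have hρ2 : ρ + ρ ≤ ρ₂ := by rw [hρdef]; linarith [min_le_right ρ₁ ρ₂]
    refine ⟨Metric.ball x₀ ρ, Metric.isOpen_ball, Metric.mem_ball_self hρ, fun ε hε => ?_⟩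
    -- For z in this open cone, subtracting s z lowers the height by at least s K‖P z‖, while γ
    -- drops by at most that amount.
    let Z : Set (Euc N) := {z | ‖z‖ < min ε ρ ∧ K * ‖P z‖ < inner ℝ e z}
    have hZo : IsOpen Z := by
      refine IsOpen.inter (s := {z | ‖z‖ < min ε ρ}) (t := {z | K * ‖P z‖ < inner ℝ e z}) ?_ ?_
      · exact isOpen_lt (by fun_prop) (by fun_prop)
      · exact isOpen_lt (by fun_prop) (by fun_prop)
    have hZne : Z.Nonempty := by
      have hτ : 0 < min ε ρ / 2 := by positivity
      refine ⟨(min ε ρ / 2) • e, ?_, ?_⟩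
      · rw [norm_smul, he, mul_one, Real.norm_of_nonneg hτ.le]
        linarith
      · rw [map_smul, hPe, smul_zero, norm_zero, mul_zero, real_inner_smul_right,
          real_inner_self_eq_norm_sq, he]
        linarith
    refine ⟨Z, hZo.measurableSet, (hZo.measure_pos _ hZne).ne', ?_, fun z hz => ?_⟩
    · refine ((measure_mono fun z hz => ?_).trans_lt
        (measure_ball_lt_top (x := (0 : Euc N)) (r := min ε ρ))).ne
      exact mem_ball_zero_iff.2 hz.1
    · obtain ⟨hz1, hz2⟩ := hz
      rw [lt_min_iff] at hz1
      refine ⟨hz1.1.le, fun x hx s hs => ?_⟩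
      have hx1 : ‖x - x₀‖ < ρ := by rw [← dist_eq_norm]; exact hx.1
      have h2 : ‖s • z‖ < ρ := by
        rw [norm_smul, Real.norm_of_nonneg hs.1]
        exact (mul_le_of_le_one_left (norm_nonneg _) hs.2).trans_lt hz1.2
      have h3 : ‖x - s • z - x₀‖ < ρ + ρ := by
        calc ‖x - s • z - x₀‖ = ‖(x - x₀) - s • z‖ := by congr 1; abel
          _ ≤ ‖x - x₀‖ + ‖s • z‖ := norm_sub_le _ _
          _ < ρ + ρ := by linarith
      have hmem : ∀ y : Euc N, ‖y - x₀‖ < ρ + ρ → y ∈ U ∧ P y ∈ t := by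
        refine fun y hy => ⟨hρU ?_, hρt ?_⟩
        · rw [Metric.mem_ball, dist_eq_norm]; linarith
        · rw [Metric.mem_ball, dist_eq_norm, ← map_sub]
          linarith [hP1 (y - x₀)]
      have hxm := hmem x (by linarith)
      have hym := hmem _ h3
      have h4 := (hgraph x hxm.1).1 hx.2
      rw [hgraph _ hym.1]
      have h5 := hK.dist_le_mul _ hxm.2 _ hym.2
      rw [dist_eq_norm, dist_eq_norm, ← map_sub, sub_sub_cancel, map_smul, norm_smul,
        Real.norm_of_nonneg hs.1, Real.norm_eq_abs] at h5
      have h6 := (abs_le.1 h5).2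
      rw [inner_sub_right, real_inner_smul_right]
      have h7 := mul_le_mul_of_nonneg_left hz2.le hs.1
      change inner ℝ e x - s * inner ℝ e z < γ (P (x - s • z))
      change inner ℝ e x < γ (P x) at h4
      nlinarith

end Rellich

/-! ### The plate form on H² as a spectral form -/

section Plate

variable {N : ℕ} {Ω : Set (Euc N)}

theorem IsWeakPartial.of_tendsto {ι : Type*} {l : Filter ι} [l.NeBot] {i : Fin N}
    {u g : ι → L2 Ω} {u₀ g₀ : L2 Ω} (h : ∀ n, IsWeakPartial Ω i (u n) (g n))
    (hu : Tendsto u l (𝓝 u₀)) (hg : Tendsto g l (𝓝 g₀)) : IsWeakPartial Ω i u₀ g₀ := by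
  intro φ hφ hc hs
  have h1 : MemLp (fun x => fderiv ℝ φ x (EuclideanSpace.single i 1)) 2 (volume.restrict Ω) :=
    (continuous_partial hφ i).memLp_of_hasCompactSupport (hc.fderiv_apply ℝ _)
  have h2 : MemLp φ 2 (volume.restrict Ω) := hφ.continuous.memLp_of_hasCompactSupport hc
  have h3 : ∀ n, inner ℝ (u n) (h1.toLp _) = -inner ℝ (g n) (h2.toLp _) := fun n => by
    rw [← integral_mul_eq_inner_toLp, ← integral_mul_eq_inner_toLp]
    exact h n φ hφ hc hs
  rw [integral_mul_eq_inner_toLp _ h1, integral_mul_eq_inner_toLp _ h2]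
  refine tendsto_nhds_unique (hu.inner tendsto_const_nhds) ?_
  simp only [h3]
  exact (hg.inner tendsto_const_nhds).neg

namespace SobolevH2

/-- The weak first derivative `∂u/∂x_i`. -/
def grad (u : SobolevH2 Ω) (i : Fin N) : L2 Ω := u.1.2.1 i

/-- The inclusion of `H²(Ω)` in `L²(Ω)`. -/
def fnₗ (Ω : Set (Euc N)) : SobolevH2 Ω →ₗ[ℝ] L2 Ω where
  toFun := fn
  map_add' _ _ := rfl
  map_smul' _ _ := rfl

theorem hess_add (u v : SobolevH2 Ω) (i j : Fin N) : hess (u + v) i j = hess u i j + hess v i j :=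
  rfl

theorem hess_sub (u v : SobolevH2 Ω) (i j : Fin N) : hess (u - v) i j = hess u i j - hess v i j :=
  rfl

theorem hess_smul (c : ℝ) (u : SobolevH2 Ω) (i j : Fin N) : hess (c • u) i j = c • hess u i j :=
  rfl

theorem lap_add (u v : SobolevH2 Ω) : lap (u + v) = lap u + lap v := by
  simp only [lap, hess_add, Finset.sum_add_distrib]

theorem lap_smul (c : ℝ) (u : SobolevH2 Ω) : lap (c • u) = c • lap u := by
  simp only [lap, hess_smul, Finset.smul_sum]

theorem hessForm_self (u : SobolevH2 Ω) : hessForm u u = ∑ i, ∑ j, ‖hess u i j‖ ^ 2 := by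
  simp only [hessForm_eq, real_inner_self_eq_norm_sq]

theorem lapForm_self (u : SobolevH2 Ω) : lapForm u u = ‖lap u‖ ^ 2 := by
  rw [lapForm_eq, real_inner_self_eq_norm_sq]

theorem hessForm_self_nonneg (u : SobolevH2 Ω) : 0 ≤ hessForm u u := by
  rw [hessForm_self]
  positivity

theorem lapForm_self_nonneg (u : SobolevH2 Ω) : 0 ≤ lapForm u u := by
  rw [lapForm_self]
  positivity

theorem norm_hess_sq_le (u : SobolevH2 Ω) (i j : Fin N) : ‖hess u i j‖ ^ 2 ≤ hessForm u u := by
  rw [hessForm_self]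
  exact (Finset.single_le_sum (f := fun j => ‖hess u i j‖ ^ 2) (fun _ _ => sq_nonneg _)
    (Finset.mem_univ j)).trans (Finset.single_le_sum (f := fun i => ∑ j, ‖hess u i j‖ ^ 2)
      (fun _ _ => Finset.sum_nonneg fun _ _ => sq_nonneg _) (Finset.mem_univ i))

/-- Cauchy–Schwarz on the N diagonal entries; the source of the factor N in the Lipschitz constant.
-/
theorem lapForm_self_le (u : SobolevH2 Ω) : lapForm u u ≤ N * hessForm u u := by
  rw [lapForm_self, hessForm_self]
  calc ‖lap u‖ ^ 2 ≤ (∑ i, ‖hess u i i‖) ^ 2 := by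
        gcongr
        exact norm_sum_le _ _
    _ ≤ N * ∑ i, ‖hess u i i‖ ^ 2 := by
        simpa using sq_sum_le_card_mul_sum_sq (s := Finset.univ) (f := fun i => ‖hess u i i‖)
    _ ≤ _ := by
        gcongr with i
        exact Finset.single_le_sum (f := fun j => ‖hess u i j‖ ^ 2) (fun _ _ => sq_nonneg _)
          (Finset.mem_univ i)

/-- First derivatives are controlled by the function and its second derivatives. -/
theorem exists_norm_grad_le (hΩ : IsOpen Ω) (hb : Bornology.IsBounded Ω)
    (hT : IsLocallyTranslatable Ω) (i : Fin N) :
    ∃ C : ℝ, 0 ≤ C ∧ ∀ u : SobolevH2 Ω, ‖grad u i‖ ≤ C * (‖fn u‖ + ∑ j, ‖hess u i j‖) := by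
  by_contra! hcon
  choose u hu using fun n : ℕ => hcon ((n : ℝ) + 1) (by positivity)
  have hpos : ∀ n, 0 < ‖grad (u n) i‖ := fun n => lt_of_le_of_lt (by positivity) (hu n)
  -- A normalised counterexample: ∂_i v has norm 1 while v and the derivatives of ∂_i v tend to 0.
  -- Rellich applied to ∂_i v gives a limit of norm 1 that is the weak derivative of 0.
  let v : ℕ → SobolevH2 Ω := fun n => ‖grad (u n) i‖⁻¹ • u n
  have hgv : ∀ n, ‖grad (v n) i‖ = 1 := fun n => by
    have : grad (v n) i = ‖grad (u n) i‖⁻¹ • grad (u n) i := rfl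
    rw [this, norm_smul, norm_inv, norm_norm, inv_mul_cancel₀ (hpos n).ne']
  have hTv : ∀ n, ‖fn (v n)‖ + ∑ j, ‖hess (v n) i j‖ ≤ 1 / ((n : ℝ) + 1) := fun n => by
    have h1 : ‖fn (v n)‖ + ∑ j, ‖hess (v n) i j‖ =
        ‖grad (u n) i‖⁻¹ * (‖fn (u n)‖ + ∑ j, ‖hess (u n) i j‖) := by
      have h2 : fn (v n) = ‖grad (u n) i‖⁻¹ • fn (u n) := rfl
      have h3 : ∀ j, hess (v n) i j = ‖grad (u n) i‖⁻¹ • hess (u n) i j := fun _ => rfl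
      simp only [h2, h3, norm_smul, norm_inv, norm_norm, mul_add, Finset.mul_sum]
    rw [h1, inv_mul_le_iff₀ (hpos n), mul_one_div, le_div_iff₀ (by positivity), mul_comm]
    exact (hu n).le
  have hle1 : ∀ n : ℕ, 1 / ((n : ℝ) + 1) ≤ 1 := fun n =>
    (div_le_one (by positivity)).2 (by linarith [n.cast_nonneg (α := ℝ)])
  obtain ⟨φ, hφ, hc⟩ := exists_cauchySeq_of_bounded hΩ hb hT (u := fun n => grad (v n) i)
    (g := fun n j => hess (v n) i j) (R := 1) (fun n => (hgv n).le)
    (fun n j => (Finset.single_le_sum (f := fun j => ‖hess (v n) i j‖) (fun _ _ => norm_nonneg _)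
      (Finset.mem_univ j)).trans ((le_add_of_nonneg_left (norm_nonneg _)).trans
        ((hTv n).trans (hle1 n)))) (fun n j => (v n).2.2 i j)
  obtain ⟨G, hG⟩ := cauchySeq_tendsto_of_complete hc
  have hfn : Tendsto (fun n => fn (v (φ n))) atTop (𝓝 0) := by
    rw [tendsto_zero_iff_norm_tendsto_zero]
    refine squeeze_zero (fun _ => norm_nonneg _) (fun n => ?_)
      (tendsto_one_div_add_atTop_nhds_zero_nat.comp hφ.tendsto_atTop)
    exact (le_add_of_nonneg_right (Finset.sum_nonneg fun _ _ => norm_nonneg _)).trans (hTv (φ n))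
  have hw := IsWeakPartial.of_tendsto (fun n => (v (φ n)).2.1 i) hfn hG
  have hG0 : G = 0 := hw.unique hΩ (.zero i)
  have hG1 : ‖G‖ = 1 := by
    refine tendsto_nhds_unique hG.norm ?_
    simp only [hgv]
    exact tendsto_const_nhds
  rw [hG0, norm_zero] at hG1
  exact zero_ne_one hG1

end SobolevH2

open SobolevH2

/-- `plateForm` as a bilinear map. -/
def plateBilin (Ω : Set (Euc N)) (σ : ℝ) : SobolevH2 Ω →ₗ[ℝ] SobolevH2 Ω →ₗ[ℝ] ℝ :=
  LinearMap.mk₂ ℝ (plateForm Ω σ)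
    (fun u v w => by
      simp only [plateForm, hessForm_eq, lapForm_eq, hess_add, lap_add, inner_add_left,
        Finset.sum_add_distrib]
      ring)
    (fun c u v => by
      simp only [plateForm, hessForm_eq, lapForm_eq, hess_smul, lap_smul, real_inner_smul_left,
        ← Finset.mul_sum, smul_eq_mul]
      ring)
    (fun u v w => by
      simp only [plateForm, hessForm_eq, lapForm_eq, hess_add, lap_add, inner_add_right,
        Finset.sum_add_distrib]
      ring)
    (fun c u v => by
      simp only [plateForm, hessForm_eq, lapForm_eq, hess_smul, lap_smul, real_inner_smul_right,
        ← Finset.mul_sum, smul_eq_mul]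
      ring)

theorem plateBilin_apply (σ : ℝ) (u v : SobolevH2 Ω) : plateBilin Ω σ u v = plateForm Ω σ u v :=
  rfl

theorem le_plateForm_self {σ : ℝ} (hσ : 0 ≤ σ) (u : SobolevH2 Ω) :
    (1 - σ) * hessForm u u ≤ plateForm Ω σ u u :=
  le_add_of_nonneg_right (mul_nonneg hσ (lapForm_self_nonneg u))

/-- For σ < 1 the form controls the Hessian through its (1 - σ) part, and `exists_norm_grad_le` then
controls the gradient. Compactness follows from Rellich, closedness from the closedness of weak
derivatives. -/
theorem isSpectralForm_plateBilin (hΩ : IsOpen Ω) (hb : Bornology.IsBounded Ω)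
    (hT : IsLocallyTranslatable Ω) {σ : ℝ} (hσ : σ ∈ Ico (0 : ℝ) 1) :
    IsSpectralForm (fnₗ Ω) (plateBilin Ω σ) := by
  have hσ1 : 0 < 1 - σ := sub_pos.2 hσ.2
  choose C hC0 hC using exists_norm_grad_le hΩ hb hT
  have hhess : ∀ (u : SobolevH2 Ω) i j,
      ‖hess u i j‖ ≤ Real.sqrt (plateForm Ω σ u u / (1 - σ)) := fun u i j => by
    refine Real.le_sqrt_of_sq_le ((norm_hess_sq_le u i j).trans ?_)
    rw [le_div_iff₀ hσ1, mul_comm]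
    exact le_plateForm_self hσ.1 u
  refine ⟨fun u v h => ext_fn hΩ h, fun u v => ?_, fun u => ?_, fun u R hu ha => ?_,
    fun u hu ha => ?_⟩
  · simp only [plateBilin_apply, plateForm, hessForm_eq, lapForm_eq]
    simp only [real_inner_comm]
  · exact (mul_nonneg hσ1.le (hessForm_self_nonneg u)).trans (le_plateForm_self hσ.1 u)
  · set R' := Real.sqrt (R / (1 - σ))
    have hess_le : ∀ n i j, ‖hess (u n) i j‖ ≤ R' := fun n i j =>
      (hhess (u n) i j).trans (Real.sqrt_le_sqrt (by gcongr; exact ha n))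
    have hR : 0 ≤ R := (norm_nonneg _).trans (hu 0)
    have hgrad : ∀ n i, ‖grad (u n) i‖ ≤ C i * (R + N * R') := fun n i => by
      refine (hC i (u n)).trans (mul_le_mul_of_nonneg_left (add_le_add (hu n) ?_) (hC0 i))
      refine (Finset.sum_le_card_nsmul _ _ R' fun j _ => hess_le n i j).trans ?_
      simp
    have hnn : ∀ i, 0 ≤ C i * (R + N * R') := fun i => (norm_nonneg _).trans (hgrad 0 i)
    refine exists_cauchySeq_of_bounded hΩ hb hT (R := R + ∑ i, C i * (R + N * R'))
      (g := fun n => grad (u n))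
      (fun n => (hu n).trans (le_add_of_nonneg_right (Finset.sum_nonneg fun i _ => hnn i)))
      (fun n i => (hgrad n i).trans ?_) (fun n i => (u n).2.1 i)
    exact (Finset.single_le_sum (fun i _ => hnn i) (Finset.mem_univ i)).trans
      (le_add_of_nonneg_left hR)
  · have hh : ∀ i j, CauchySeq fun n => hess (u n) i j := fun i j => by
      refine Metric.cauchySeq_iff.2 fun ε hε => ?_
      obtain ⟨n₀, hn₀⟩ := ha ((1 - σ) * ε ^ 2) (by positivity)
      refine ⟨n₀, fun n hn m hm => ?_⟩
      rw [dist_eq_norm, ← hess_sub]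
      refine (hhess _ i j).trans_lt ((Real.sqrt_lt' hε).2 ?_)
      rw [div_lt_iff₀ hσ1, mul_comm]
      exact hn₀ n hn m hm
    have hg : ∀ i, CauchySeq fun n => grad (u n) i := fun i => by
      have hu' := cauchySeq_iff_tendsto_dist_atTop_0.1 hu
      have hh' := fun j => cauchySeq_iff_tendsto_dist_atTop_0.1 (hh i j)
      rw [cauchySeq_iff_tendsto_dist_atTop_0]
      have h1 := (hu'.add (tendsto_finsetSum Finset.univ fun j _ => hh' j)).const_mul (C i)
      rw [Finset.sum_const_zero, add_zero, mul_zero] at h1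
      refine squeeze_zero (fun _ => dist_nonneg) (fun n => ?_) h1
      simp only [dist_eq_norm]
      exact hC i (u n.1 - u n.2)
    obtain ⟨f, hf⟩ := cauchySeq_tendsto_of_complete hu
    choose G hG using fun i => cauchySeq_tendsto_of_complete (hg i)
    choose K hK using fun i j => cauchySeq_tendsto_of_complete (hh i j)
    refine ⟨⟨(f, G, K), fun i => .of_tendsto (fun n => (u n).2.1 i) hf (hG i),
      fun i j => .of_tendsto (fun n => (u n).2.2 i j) (hG i) (hK i j)⟩, hf, ?_⟩
    simp only [plateBilin_apply, plateForm, hessForm_eq, lapForm_eq]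
    refine Tendsto.add (Tendsto.const_mul _ ?_) (Tendsto.const_mul _ ?_)
    · exact tendsto_finsetSum _ fun i _ => tendsto_finsetSum _ fun j _ => (hK i j).inner (hK i j)
    · exact (tendsto_finsetSum _ fun i _ => hK i i).inner (tendsto_finsetSum _ fun i _ => hK i i)

theorem neumannEigenspace_eq (σ t : ℝ) :
    neumannEigenspace Ω σ t = formEigenspace (fnₗ Ω) (plateBilin Ω σ) t := by
  ext u
  refine forall_congr' fun φ => ?_
  rw [massForm_eq]
  rfl

theorem neumannEigenvalue_eq (j : ℕ) (σ : ℝ) :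
    neumannEigenvalue Ω j σ = formEigenvalue (fnₗ Ω) (plateBilin Ω σ) j := by
  have h : neumannEigenspace Ω σ = formEigenspace (fnₗ Ω) (plateBilin Ω σ) :=
    funext fun t => neumannEigenspace_eq σ t
  rw [neumannEigenvalue, h]
  rfl

end Plate

open SobolevH2

/-! ### Harmonic subspaces of H² of arbitrary finite dimension -/

section Harmonic

variable {N : ℕ} {Ω : Set (Euc N)}

theorem _root_.Continuous.memLp_restrict_of_isBounded {f : Euc N → ℝ} (hf : Continuous f)
    (hΩ : IsOpen Ω) (hb : Bornology.IsBounded Ω) : MemLp f 2 (volume.restrict Ω) := by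
  have := isFiniteMeasure_restrict_of_isBounded hb
  obtain ⟨C, hC⟩ := hb.isCompact_closure.exists_bound_of_continuousOn hf.continuousOn
  refine MemLp.of_bound hf.aestronglyMeasurable C ?_
  filter_upwards [ae_restrict_mem hΩ.measurableSet] with x hx using hC x (subset_closure hx)

/-- The test function vanishes outside Ω, so both integrals extend to the whole space, where
integration by parts has no boundary term. -/
theorem isWeakPartial_toLp {f g : Euc N → ℝ} {i : Fin N} (hf : Differentiable ℝ f)
    (hg : Continuous g) (hfg : ∀ x, fderiv ℝ f x (EuclideanSpace.single i 1) = g x)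
    (hf2 : MemLp f 2 (volume.restrict Ω)) (hg2 : MemLp g 2 (volume.restrict Ω)) :
    IsWeakPartial Ω i (hf2.toLp f) (hg2.toLp g) := by
  intro φ hφ hc hs
  have hφ' : IsTestFunction Ω φ := ⟨hφ, hc, hs⟩
  have hd : ∀ x, x ∉ Ω → fderiv ℝ φ x (EuclideanSpace.single i 1) = 0 := fun x hx => by
    rw [image_eq_zero_of_notMem_tsupport
      fun h => hx (hs (tsupport_fderiv_subset ℝ h)), zero_apply]
  have h1 : ∫ x in Ω, (hf2.toLp f) x * fderiv ℝ φ x (EuclideanSpace.single i 1) =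
      ∫ x, f x * fderiv ℝ φ x (EuclideanSpace.single i 1) := by
    rw [← setIntegral_eq_integral_of_forall_compl_eq_zero (s := Ω)
      (f := fun x => f x * fderiv ℝ φ x (EuclideanSpace.single i 1))
      fun x hx => by rw [hd x hx, mul_zero]]
    refine integral_congr_ae ?_
    filter_upwards [hf2.coeFn_toLp] with x hx
    rw [hx]
  have h2 : ∫ x in Ω, (hg2.toLp g) x * φ x = ∫ x, g x * φ x := by
    rw [← setIntegral_eq_integral_of_forall_compl_eq_zero (s := Ω) (f := fun x => g x * φ x)
      fun x hx => by rw [hφ'.eq_zero_of_notMem hx, mul_zero]]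
    refine integral_congr_ae ?_
    filter_upwards [hg2.coeFn_toLp] with x hx
    rw [hx]
  rw [h1, h2, integral_mul_fderiv_eq_neg_fderiv_mul_of_integrable]
  · simp only [hfg]
  · simp only [hfg]
    exact (hg.mul hφ.continuous).integrable_of_hasCompactSupport hc.mul_left
  · exact (hf.continuous.mul (continuous_partial hφ i)).integrable_of_hasCompactSupport
      (hc.fderiv_apply ℝ _).mul_left
  · exact (hf.continuous.mul hφ.continuous).integrable_of_hasCompactSupport hc.mul_left
  · exact fun x _ => hf x
  · exact fun x _ => hφ.differentiable (by simp) x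

/-- The harmonic function `exp (k x_a) cos (k (x_b - p) + θ)`. -/
def expCos (a b : Fin N) (p k θ : ℝ) (x : Euc N) : ℝ :=
  Real.exp (k * x a) * Real.cos (k * (x b - p) + θ)

variable (a b : Fin N) (p k θ : ℝ)

/-- The coordinate `x_a` as a continuous linear functional. -/
def coordCLM : Euc N →L[ℝ] ℝ := EuclideanSpace.proj a

theorem coordCLM_apply (x : Euc N) : coordCLM a x = x a := rfl

theorem continuous_expCos : Continuous (expCos a b p k θ) := by
  unfold expCos
  fun_prop

theorem hasFDerivAt_expCos (x : Euc N) :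
    HasFDerivAt (expCos a b p k θ)
      ((k * expCos a b p k θ x) • coordCLM a +
        (k * expCos a b p k (θ + Real.pi / 2) x) •
          coordCLM b) x := by
  have ha := (coordCLM a).hasFDerivAt (x := x)
  have hb := (coordCLM b).hasFDerivAt (x := x)
  refine ((ha.const_mul k).exp.mul (((hb.sub_const p).const_mul k).add_const θ).cos).congr_fderiv ?_
  ext v
  simp only [expCos, ← add_assoc, Real.cos_add_pi_div_two, add_apply,
    smul_apply, coordCLM_apply, smul_eq_mul]
  ring

variable (hΩ : IsOpen Ω) (hb : Bornology.IsBounded Ω)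

/-- `expCos` as an element of `L²(Ω)`. -/
def expCosL2 : L2 Ω :=
  ((continuous_expCos a b p k θ).memLp_restrict_of_isBounded hΩ hb).toLp _

/-- The first derivatives of `expCos`. -/
def expCosGrad (i : Fin N) : L2 Ω :=
  if i = a then k • expCosL2 a b p k θ hΩ hb
  else if i = b then k • expCosL2 a b p k (θ + Real.pi / 2) hΩ hb else 0

/-- The second derivatives of `expCos`. -/
def expCosHess (i j : Fin N) : L2 Ω :=
  if i = a then k • expCosGrad a b p k θ hΩ hb j
  else if i = b then k • expCosGrad a b p k (θ + Real.pi / 2) hΩ hb j else 0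

variable {a b}

theorem isWeakPartial_expCosL2 (hab : a ≠ b) (i : Fin N) :
    IsWeakPartial Ω i (expCosL2 a b p k θ hΩ hb) (expCosGrad a b p k θ hΩ hb i) := by
  have hdiff : Differentiable ℝ (expCos a b p k θ) := fun x =>
    (hasFDerivAt_expCos a b p k θ x).differentiableAt
  have hc : ∀ θ', Continuous (k • expCos a b p k θ') := fun θ' =>
    (continuous_expCos a b p k θ').const_smul k
  have hd : ∀ x, fderiv ℝ (expCos a b p k θ) x (EuclideanSpace.single i 1) =
      k * expCos a b p k θ x * (if a = i then 1 else 0) +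
        k * expCos a b p k (θ + Real.pi / 2) x * (if b = i then 1 else 0) := fun x => by
    rw [(hasFDerivAt_expCos a b p k θ x).fderiv]
    simp [coordCLM_apply]
  unfold expCosGrad
  split_ifs with h1 h2
  · subst h1
    exact isWeakPartial_toLp hdiff (hc θ) (fun x => by simp [hd, hab.symm]) _
      ((hc θ).memLp_restrict_of_isBounded hΩ hb)
  · subst h2
    exact isWeakPartial_toLp hdiff (hc _) (fun x => by simp [hd, hab]) _
      ((hc _).memLp_restrict_of_isBounded hΩ hb)
  · exact isWeakPartial_toLp hdiff (continuous_zero (X := Euc N))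
      (fun x => by simp [hd, Ne.symm h1, Ne.symm h2]) _
      ((continuous_zero (X := Euc N)).memLp_restrict_of_isBounded hΩ hb)

/-- `expCos` as an element of `H²(Ω)`. -/
def expCosH2 (hab : a ≠ b) : SobolevH2 Ω :=
  ⟨(expCosL2 a b p k θ hΩ hb, expCosGrad a b p k θ hΩ hb, expCosHess a b p k θ hΩ hb),
    isWeakPartial_expCosL2 p k θ hΩ hb hab, fun i j => by
      dsimp only
      unfold expCosHess
      conv in expCosGrad a b p k θ hΩ hb i => unfold expCosGrad
      split_ifs
      · exact (isWeakPartial_expCosL2 p k θ hΩ hb hab j).smul k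
      · exact (isWeakPartial_expCosL2 p k _ hΩ hb hab j).smul k
      · exact .zero j⟩

/-- Differentiating in x_b shifts the phase by π/2; two shifts change the sign, cancelling the
second derivative in x_a. -/
theorem lap_expCosH2 (hab : a ≠ b) : lap (expCosH2 p k θ hΩ hb hab) = 0 := by
  have h1 : expCosL2 a b p k (θ + Real.pi / 2 + Real.pi / 2) hΩ hb =
      -expCosL2 a b p k θ hΩ hb := by
    rw [expCosL2, expCosL2, ← MemLp.toLp_neg]
    congr 1
    funext x
    simp [expCos, ← add_assoc, Real.cos_add_pi_div_two, Real.sin_add_pi_div_two]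
  change ∑ i, expCosHess a b p k θ hΩ hb i i = 0
  rw [Finset.sum_eq_add a b hab]
  · simp [expCosHess, expCosGrad, hab.symm, h1]
  · intro c _ hc
    simp [expCosHess, hc.1, hc.2]
  · simp
  · simp

theorem expCosL2_ne_zero {q : Euc N} (hq : q ∈ Ω) :
    expCosL2 a b (q b) k 0 hΩ hb ≠ 0 := by
  intro h0
  have h1 : expCos a b (q b) k 0 =ᵐ[volume.restrict Ω] fun _ => 0 := by
    have h2 := ((continuous_expCos a b (q b) k 0).memLp_restrict_of_isBounded hΩ hb).coeFn_toLp
    have h3 := Lp.coeFn_zero ℝ 2 (volume.restrict Ω)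
    change (expCosL2 a b (q b) k 0 hΩ hb : Euc N → ℝ) =ᵐ[_] _ at h2
    rw [h0] at h2
    exact h2.symm.trans h3
  have h2 := Measure.eqOn_open_of_ae_eq h1 hΩ (continuous_expCos a b (q b) k 0).continuousOn
    continuousOn_const hq
  -- Centring the cosine at the coordinate of q makes its argument vanish there, so the value at q
  -- is a positive exponential.
  simp [expCos, Real.exp_ne_zero] at h2

/-- These are nonzero eigenvectors of the weak ∂_a with distinct eigenvalues n; uniqueness of weak
derivatives makes the usual elimination argument available. -/
theorem linearIndependent_expCosL2 (hab : a ≠ b) {q : Euc N} (hq : q ∈ Ω) :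
    LinearIndependent ℝ fun n : ℕ => expCosL2 a b (q b) n 0 hΩ hb := by
  set f : ℕ → L2 Ω := fun n => expCosL2 a b (q b) n 0 hΩ hb with hf
  have hD : ∀ n : ℕ, IsWeakPartial Ω a (f n) ((n : ℝ) • f n) := fun n => by
    have := isWeakPartial_expCosL2 (q b) n 0 hΩ hb hab a
    rwa [expCosGrad, if_pos rfl] at this
  have hDsum : ∀ (s : Finset ℕ) (c : ℕ → ℝ),
      IsWeakPartial Ω a (∑ n ∈ s, c n • f n) (∑ n ∈ s, c n • (n : ℝ) • f n) := by
    intro s c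
    induction s using Finset.induction_on with
    | empty => simpa using IsWeakPartial.zero a
    | insert m s hm ih =>
      rw [Finset.sum_insert hm, Finset.sum_insert hm]
      exact ((hD m).smul _).add ih
  rw [linearIndependent_iff']
  intro s
  induction s using Finset.induction_on with
  | empty => simp
  | insert m s hm ih =>
    intro c hc
    have h1 := hDsum (insert m s) c
    rw [hc] at h1
    have h2 := h1.unique hΩ (.zero a)
    -- Applying ∂_a - m to the relation removes the term with index m.
    have h3 : ∑ n ∈ s, (c n * ((n : ℝ) - m)) • f n = 0 := by
      have h4 : ∑ n ∈ insert m s, (c n * ((n : ℝ) - m)) • f n = 0 := by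
        have : ∀ n, (c n * ((n : ℝ) - m)) • f n = c n • (n : ℝ) • f n - (m : ℝ) • c n • f n :=
          fun n => by rw [smul_smul, smul_smul, ← sub_smul]; congr 1; ring
        simp only [this]
        rw [Finset.sum_sub_distrib, ← Finset.smul_sum, hc, h2, smul_zero, sub_zero]
      rwa [Finset.sum_insert hm, sub_self, mul_zero, zero_smul, zero_add] at h4
    have h5 : ∀ n ∈ s, c n = 0 := fun n hn => by
      refine (mul_eq_zero.1 (ih _ h3 n hn)).resolve_right (sub_ne_zero.2 ?_)
      exact_mod_cast fun e : n = m => hm (e ▸ hn)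
    intro n hn
    rcases Finset.mem_insert.1 hn with rfl | hn
    · rw [Finset.sum_insert hm, Finset.sum_eq_zero fun i hi => by rw [h5 i hi, zero_smul],
        add_zero] at hc
      exact (smul_eq_zero.1 hc).resolve_right (expCosL2_ne_zero _ hΩ hb hq)
    · exact h5 n hn

include hΩ hb in
/-- `H²(Ω)` contains harmonic subspaces of every finite dimension. -/
theorem exists_harmonic_submodule (hN : 2 ≤ N) (hne : Ω.Nonempty) (j : ℕ) :
    ∃ F : Submodule ℝ (SobolevH2 Ω), FiniteDimensional ℝ F ∧ Module.finrank ℝ F = j ∧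
      ∀ u ∈ F, lap u = 0 := by
  obtain ⟨q, hq⟩ := hne
  let a : Fin N := ⟨0, by omega⟩
  let b : Fin N := ⟨1, by omega⟩
  have hab : a ≠ b := by simp [a, b]
  let U : ℕ → SobolevH2 Ω := fun n => expCosH2 (q b) n 0 hΩ hb hab
  have hU : LinearIndependent ℝ U :=
    LinearIndependent.of_comp (fnₗ Ω) (linearIndependent_expCosL2 hΩ hb hab hq)
  have hUj : LinearIndependent ℝ fun n : Fin j => U n := hU.comp _ Fin.val_injective
  refine ⟨Submodule.span ℝ (range fun n : Fin j => U n),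
    FiniteDimensional.span_of_finite ℝ (finite_range _), ?_, fun u hu => ?_⟩
  · rw [finrank_span_eq_card hUj, Fintype.card_fin]
  · induction hu using Submodule.span_induction with
    | mem u hu =>
      obtain ⟨n, rfl⟩ := hu
      exact lap_expCosH2 (q b) n 0 hΩ hb hab
    | zero => simpa using lap_smul 0 (0 : SobolevH2 Ω)
    | add u v _ _ hu hv => rw [lap_add, hu, hv, add_zero]
    | smul c u _ hu => rw [lap_smul, hu, smul_zero]

end Harmonic

/-! ### Bounds for the eigenvalues as σ varies -/

section Eigenvalues

variable {N : ℕ} {Ω : Set (Euc N)}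

/-- `λ_j(σ) = O(1 - σ)`. -/
theorem exists_neumannEigenvalue_le (hΩ : IsOpen Ω) (hb : Bornology.IsBounded Ω)
    (hT : IsLocallyTranslatable Ω) (hN : 2 ≤ N) (hne : Ω.Nonempty) {j : ℕ} (hj : 1 ≤ j) :
    ∃ C : ℝ, 0 ≤ C ∧ ∀ σ ∈ Ico (0 : ℝ) 1, neumannEigenvalue Ω j σ ≤ C * (1 - σ) := by
  obtain ⟨F, hF, hFj, hlap⟩ := exists_harmonic_submodule hΩ hb hN hne j
  have h0 := isSpectralForm_plateBilin hΩ hb hT (left_mem_Ico.2 zero_lt_one)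
  -- At σ = 0 the form is the Hessian form alone, so C does not depend on σ.
  obtain ⟨C, hC, hCF⟩ := exists_form_le_mul_norm_sq h0.injective (plateBilin Ω 0) F
  refine ⟨C, hC, fun σ hσ => ?_⟩
  rw [neumannEigenvalue_eq]
  refine (isSpectralForm_plateBilin hΩ hb hT hσ).formEigenvalue_le_of_form_le hj F hFj.ge
    fun u hu => ?_
  have h1 := hCF u hu
  have h2 : lapForm u u = 0 := by rw [lapForm_self, hlap u hu, norm_zero, sq, mul_zero]
  simp only [plateBilin_apply, plateForm, h2, mul_zero, add_zero, sub_zero, one_mul] at h1 ⊢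
  calc (1 - σ) * hessForm u u ≤ (1 - σ) * (C * ‖fnₗ Ω u‖ ^ 2) :=
        mul_le_mul_of_nonneg_left h1 (sub_pos.2 hσ.2).le
    _ = _ := by ring

/-- The eigensum at σ serves as trial space for the problem at τ; its Hessian energy is bounded
uniformly in σ. -/
theorem neumannEigenvalue_le_add (hΩ : IsOpen Ω) (hb : Bornology.IsBounded Ω)
    (hT : IsLocallyTranslatable Ω) (hN : 2 ≤ N) (hne : Ω.Nonempty) {j : ℕ} (hj : 1 ≤ j) {C : ℝ}
    (hC : ∀ σ ∈ Ico (0 : ℝ) 1, neumannEigenvalue Ω j σ ≤ C * (1 - σ)) {σ τ : ℝ}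
    (hσ : σ ∈ Ico (0 : ℝ) 1) (hτ : τ ∈ Ico (0 : ℝ) 1) :
    neumannEigenvalue Ω j τ ≤ neumannEigenvalue Ω j σ + N * C * |τ - σ| := by
  have hS := isSpectralForm_plateBilin hΩ hb hT hσ
  have hinf : ∀ j : ℕ, ∃ F : Submodule ℝ (SobolevH2 Ω),
      FiniteDimensional ℝ F ∧ Module.finrank ℝ F = j := fun j =>
    let ⟨F, h1, h2, _⟩ := exists_harmonic_submodule hΩ hb hN hne j
    ⟨F, h1, h2⟩
  have hle := hC σ hσ
  rw [neumannEigenvalue_eq, neumannEigenvalue_eq] at *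
  set m := formEigenvalue (fnₗ Ω) (plateBilin Ω σ) j
  have := hS.finiteDimensional m
  refine (isSpectralForm_plateBilin hΩ hb hT hτ).formEigenvalue_le_of_form_le hj
    (formEigensum (fnₗ Ω) (plateBilin Ω σ) m)
    (hS.le_finrank_formEigensum_formEigenvalue hinf j) fun u hu => ?_
  have h1 := hS.form_le_of_mem hu
  rw [plateBilin_apply] at h1 ⊢
  set M := ‖fnₗ Ω u‖ ^ 2
  have hM : 0 ≤ M := sq_nonneg _
  have hσ1 : 0 < 1 - σ := sub_pos.2 hσ.2
  -- The coercivity constant 1 - σ cancels against the bound C (1 - σ) on the eigenvalue, so nothing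
  -- blows up as σ → 1.
  have hA : hessForm u u ≤ C * M := by
    refine le_of_mul_le_mul_left ?_ hσ1
    calc (1 - σ) * hessForm u u ≤ plateForm Ω σ u u := le_plateForm_self hσ.1 u
      _ ≤ m * M := h1
      _ ≤ C * (1 - σ) * M := mul_le_mul_of_nonneg_right hle hM
      _ = _ := by ring
  have hN1 : (1 : ℝ) ≤ N := by exact_mod_cast (by omega : 1 ≤ N)
  have hA0 := hessForm_self_nonneg u
  have hB0 := lapForm_self_nonneg u
  have hB := lapForm_self_le u
  have hAN : N * hessForm u u ≤ N * (C * M) := mul_le_mul_of_nonneg_left hA (by positivity)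
  have hAN' : hessForm u u ≤ N * hessForm u u := le_mul_of_one_le_left hA0 hN1
  have hdiff : |lapForm u u - hessForm u u| ≤ N * (C * M) :=
    abs_le.2 ⟨by linarith, by linarith⟩
  calc plateForm Ω τ u u
      = plateForm Ω σ u u + (τ - σ) * (lapForm u u - hessForm u u) := by
        simp only [plateForm]; ring
    _ ≤ m * M + |τ - σ| * (N * (C * M)) := by
        refine add_le_add h1 ((le_abs_self _).trans ?_)
        rw [abs_mul]
        exact mul_le_mul_of_nonneg_left hdiff (abs_nonneg _)
    _ = _ := by ring

theorem listsNeumannEigenvalues (hΩ : IsOpen Ω) (hb : Bornology.IsBounded Ω)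
    (hT : IsLocallyTranslatable Ω) (hN : 2 ≤ N) (hne : Ω.Nonempty) {σ : ℝ}
    (hσ : σ ∈ Ico (0 : ℝ) 1) : ListsNeumannEigenvalues Ω σ fun j => neumannEigenvalue Ω j σ := by
  have hS := isSpectralForm_plateBilin hΩ hb hT hσ
  have hinf : ∀ j : ℕ, ∃ F : Submodule ℝ (SobolevH2 Ω),
      FiniteDimensional ℝ F ∧ Module.finrank ℝ F = j := fun j =>
    let ⟨F, h1, h2, _⟩ := exists_harmonic_submodule hΩ hb hN hne j
    ⟨F, h1, h2⟩
  simp only [neumannEigenvalue_eq]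
  refine ⟨fun j k hj hjk => hS.formEigenvalue_mono hinf hj hjk, hS.tendsto_formEigenvalue hinf,
    fun t => ?_, fun t => ?_⟩
  · rw [neumannEigenspace_eq]
    exact hS.finite_formEigenspace t
  · rw [neumannEigenspace_eq]
    exact hS.finrank_formEigenspace hinf t

end Eigenvalues

end NeumannBiharmonic

end

/-! ### The limit σ → 1 and the Lipschitz estimate on the closed interval -/

open NeumannBiharmonic in
theorem mainTheorem1 (N : ℕ) (hN : 2 ≤ N) (α : ℝ≥0) (hα₀ : 0 < α) (hα₁ : α < 1)
    (Ω : Set (Euc N)) (hΩ : IsBoundedHolderDomain 4 α Ω) :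
    (∀ σ ∈ Ico (0 : ℝ) 1,
      ListsNeumannEigenvalues Ω σ (fun j => neumannEigenvalue Ω j σ)) ∧
    ∀ j : ℕ, 1 ≤ j →
      Tendsto (fun σ : ℝ => neumannEigenvalue Ω j σ) (𝓝[<] 1) (𝓝 0) ∧
      ∃ K : ℝ≥0, LipschitzOnWith K
        (fun σ : ℝ => if σ = 1 then 0 else neumannEigenvalue Ω j σ) (Icc 0 1) := by
  obtain ⟨ho, hc, hb, hbd⟩ := hΩ
  have hT := isLocallyTranslatable (by norm_num) ho hbd
  refine ⟨fun σ hσ => listsNeumannEigenvalues ho hb hT hN hc.nonempty hσ, fun j hj => ?_⟩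
  obtain ⟨C, hC0, hC⟩ := exists_neumannEigenvalue_le ho hb hT hN hc.nonempty hj
  have hnn : ∀ σ ∈ Ico (0 : ℝ) 1, 0 ≤ neumannEigenvalue Ω j σ := fun σ hσ => by
    rw [neumannEigenvalue_eq]
    exact (isSpectralForm_plateBilin ho hb hT hσ).formEigenvalue_nonneg hj
  have hIoo : ∀ᶠ σ : ℝ in 𝓝[<] 1, σ ∈ Ico (0 : ℝ) 1 := by
    filter_upwards [Ioo_mem_nhdsLT (zero_lt_one (α := ℝ))] with σ hσ using ⟨hσ.1.le, hσ.2⟩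
  constructor
  · have hlim : Tendsto (fun σ : ℝ => C * (1 - σ)) (𝓝[<] 1) (𝓝 0) := by
      have : Continuous fun σ : ℝ => C * (1 - σ) := by fun_prop
      simpa using (this.tendsto 1).mono_left nhdsWithin_le_nhds
    exact tendsto_of_tendsto_of_tendsto_of_le_of_le' tendsto_const_nhds hlim
      (hIoo.mono hnn) (hIoo.mono hC)
  · have hNC : C ≤ N * C :=
      le_mul_of_one_le_left hC0 (by exact_mod_cast (by omega : 1 ≤ N))
    -- A one-sided estimate for all ordered pairs suffices. When σ = 1 it is nonnegativity of the
    -- eigenvalue; when τ = 1 it is the bound C (1 - σ) together with C ≤ N C.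
    refine ⟨(N * C).toNNReal, LipschitzOnWith.of_le_add_mul _ fun σ hσ τ hτ => ?_⟩
    rw [Real.coe_toNNReal _ (by positivity), Real.dist_eq]
    by_cases hσ1 : σ = 1 <;> by_cases hτ1 : τ = 1
    · simp [hσ1, hτ1]
    · have hτ' : τ ∈ Ico (0 : ℝ) 1 := ⟨hτ.1, lt_of_le_of_ne hτ.2 hτ1⟩
      simp only [hσ1, hτ1, if_true, if_false]
      exact add_nonneg (hnn τ hτ') (by positivity)
    · have hσ' : σ ∈ Ico (0 : ℝ) 1 := ⟨hσ.1, lt_of_le_of_ne hσ.2 hσ1⟩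
      simp only [hσ1, hτ1, if_true, if_false, zero_add]
      rw [abs_sub_comm, abs_of_pos (sub_pos.2 hσ'.2)]
      exact (hC σ hσ').trans (mul_le_mul_of_nonneg_right hNC (sub_pos.2 hσ'.2).le)
    · have hσ' : σ ∈ Ico (0 : ℝ) 1 := ⟨hσ.1, lt_of_le_of_ne hσ.2 hσ1⟩
      have hτ' : τ ∈ Ico (0 : ℝ) 1 := ⟨hτ.1, lt_of_le_of_ne hτ.2 hτ1⟩
      simp only [hσ1, hτ1, if_false]
      exact neumannEigenvalue_le_add ho hb hT hN hc.nonempty hj hC hτ' hσ'
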